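/- Let $\mathcal W=W(2,2)$ be the complex Lie algebra with $\mathbb C$-basis $\{L_n, W_n, z \mid n\in\mathbb Z\}$ and brackets $$[L_n,L_m]=(m-n)L_{m+n}+\tfrac{n^3-n}{12}\delta_{m+n,0}\,z,\qquad [L_n,W_m]=(m-n)W_{m+n}+\tfrac{n^3-n}{12}\delta_{m+n,0}\,z,$$ $$[W_n,W_m]=[z,W_m]=[z,L_m]=0 ,$$ and let $\mathcal W_+$ be the subalgebra spanned by the $L_n, W_n$ with $n>0$. Let $\varphi:\mathcal W_+\to\mathbb C$ be a Lie algebra homomorphism that is non-singular, i.e. $\varphi(L_i)\varphi(W_i)\neq 0$ for $i=1,2$. Let $\mathbb C_\varphi$ be the one-dimensional $\mathcal W_+$-module on which $x$ acts as the scalar $\varphi(x)$, let $M_\varphi=\mathcal U(\mathcal W)\otimes_{\mathcal U(\mathcal W_+)}\mathbb C_\varphi$ and $w=1\otimes 1\in M_\varphi$. For $\xi\in\mathbb C$ let $L_{\varphi,\xi}=M_\varphi/(z-\xi)M_\varphi$ and let $\overline w$ be the image of $w$ in $L_{\varphi,\xi}$. A vector $v$ of a $\mathcal W$-module is called a Whittaker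 vector (of type $\varphi$) if $xv=\varphi(x)v$ for all $x\in\mathcal W_+$. A non-positive partition is a finite, possibly empty, sequence of integers $\lambda=(\lambda_1\le\lambda_2\le\dots\le\lambda_r)$ with all $\lambda_i\le 0$; put $L_\lambda=L_{\lambda_1}L_{\lambda_2}\cdots L_{\lambda_r}$ and $W_\lambda=W_{\lambda_1}W_{\lambda_2}\cdots W_{\lambda_r}$ in $\mathcal U(\mathcal W)$ (equal to $1$ for the empty sequence). **Proposition 3.2.** For every non-singular $\varphi$ and every $\xi\in\mathbb C$: 1. the vectors $L_\lambda W_\mu\overline w$, indexed by the pairs $(\lambda,\mu)$ of non-positive partitions, form a basis of $L_{\varphi,\xi}$ over $\mathbb C$; 2. if $w'\in L_{\varphi,\xi}$ is a Whittaker vector (of type $\varphi$), then $w'=c\,\overline w$ for some $c\in\mathbb C$. -/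

import Mathlib

open scoped TensorProduct

namespace W22

/-- Labels of the standard basis `{L n, W n, z | n ∈ ℤ}` of the Lie algebra `W(2,2)`. -/
inductive Gen where
  | L (n : ℤ) : Gen
  | W (n : ℤ) : Gen
  | z : Gen

end W22

/-- The underlying complex vector space of the Lie algebra `W(2,2)`: it has the basis
`{L n, W n, z | n ∈ ℤ}`. -/
def W22 : Type := W22.Gen →₀ ℂ

namespace W22

noncomputable instance : AddCommGroup W22 := inferInstanceAs (AddCommGroup (Gen →₀ ℂ))

noncomputable instance : Module ℂ W22 := inferInstanceAs (Module ℂ (Gen →₀ ℂ))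

/-- The standard basis of `W(2,2)`. -/
noncomputable def stdBasis : Module.Basis Gen ℂ W22 := Module.Basis.ofRepr (LinearEquiv.refl ℂ _)

/-- The basis element `L n`. -/
noncomputable def L (n : ℤ) : W22 := stdBasis (Gen.L n)

/-- The basis element `W n`. -/
noncomputable def W (n : ℤ) : W22 := stdBasis (Gen.W n)

/-- The basis element `z`. -/
noncomputable def z : W22 := stdBasis Gen.z

theorem stdBasis_L (n : ℤ) : stdBasis (Gen.L n) = L n := rfl

theorem stdBasis_W (n : ℤ) : stdBasis (Gen.W n) = W n := rfl

theorem stdBasis_z : stdBasis Gen.z = z := rfl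

/-- The central term `(n ^ 3 - n) / 12 * δ_{m + n, 0}`. -/
noncomputable def centralCoeff (n m : ℤ) : ℂ :=
  if m + n = 0 then ((n : ℂ) ^ 3 - n) / 12 else 0

/-- The Lie brackets of basis elements. -/
noncomputable def genBracket : Gen → Gen → W22
  | Gen.L n, Gen.L m => ((m : ℂ) - n) • L (m + n) + centralCoeff n m • z
  | Gen.L n, Gen.W m => ((m : ℂ) - n) • W (m + n) + centralCoeff n m • z
  | Gen.W n, Gen.L m => -(((n : ℂ) - m) • W (n + m) + centralCoeff m n • z)
  | Gen.W _, Gen.W _ => 0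
  | Gen.z, _ => 0
  | _, Gen.z => 0

/-- The bilinear extension of the bracket of basis elements. -/
noncomputable def bracketMap : W22 →ₗ[ℂ] W22 →ₗ[ℂ] W22 :=
  stdBasis.constr ℂ fun a => stdBasis.constr ℂ fun b => genBracket a b

noncomputable instance : Bracket W22 W22 := ⟨fun x y => bracketMap x y⟩

theorem bracket_def (x y : W22) : ⁅x, y⁆ = bracketMap x y := rfl

theorem bracketMap_stdBasis (a b : Gen) :
    bracketMap (stdBasis a) (stdBasis b) = genBracket a b := by
  simp [bracketMap]

theorem bracketMap_LL (n m : ℤ) :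
    bracketMap (L n) (L m) = ((m : ℂ) - n) • L (m + n) + centralCoeff n m • z :=
  bracketMap_stdBasis _ _

theorem bracketMap_LW (n m : ℤ) :
    bracketMap (L n) (W m) = ((m : ℂ) - n) • W (m + n) + centralCoeff n m • z :=
  bracketMap_stdBasis _ _

theorem bracketMap_WL (n m : ℤ) :
    bracketMap (W n) (L m) = -(((n : ℂ) - m) • W (n + m) + centralCoeff m n • z) :=
  bracketMap_stdBasis _ _

theorem bracketMap_WW (n m : ℤ) : bracketMap (W n) (W m) = 0 :=
  bracketMap_stdBasis _ _

theorem bracketMap_z_left (x : W22) : bracketMap z x = 0 := by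
  have h : bracketMap z = 0 := stdBasis.ext fun b => by
    simpa [z, genBracket] using bracketMap_stdBasis Gen.z b
  rw [h, LinearMap.zero_apply]

theorem bracketMap_z_right (x : W22) : bracketMap x z = 0 := by
  have h : bracketMap.flip z = 0 := stdBasis.ext fun b => by
    cases b <;> simpa [z, genBracket] using bracketMap_stdBasis _ Gen.z
  simpa using LinearMap.congr_fun h x

theorem centralCoeff_symm (n m : ℤ) : centralCoeff m n = -centralCoeff n m := by
  unfold centralCoeff
  by_cases h : m + n = 0
  · obtain rfl : m = -n := by omega
    simp
    ring
  · rw [if_neg h, if_neg (by omega)]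
    simp

theorem bracketMap_skew (x y : W22) : bracketMap x y = -bracketMap y x := by
  have h : bracketMap = -bracketMap.flip := by
    refine stdBasis.ext fun a => stdBasis.ext fun b => ?_
    rw [LinearMap.neg_apply, LinearMap.neg_apply, LinearMap.flip_apply]
    cases a with
    | z => simp [stdBasis_z, bracketMap_z_left, bracketMap_z_right]
    | L n =>
      cases b with
      | z => simp [stdBasis_z, bracketMap_z_left, bracketMap_z_right]
      | L m =>
        simp only [stdBasis_L, bracketMap_LL]
        rw [centralCoeff_symm n m, add_comm n m]
        module
      | W m => simp only [stdBasis_L, stdBasis_W, bracketMap_LW, bracketMap_WL, neg_neg]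
    | W n =>
      cases b with
      | z => simp [stdBasis_z, bracketMap_z_left, bracketMap_z_right]
      | L m => simp only [stdBasis_L, stdBasis_W, bracketMap_LW, bracketMap_WL]
      | W m => simp only [stdBasis_W, bracketMap_WW, neg_zero]
  have h' := LinearMap.congr_fun (LinearMap.congr_fun h x) y
  rwa [LinearMap.neg_apply, LinearMap.neg_apply, LinearMap.flip_apply] at h'

/-- The cocycle identity behind the Jacobi identity. -/
theorem centralCoeff_cocycle (n m k : ℤ) :
    ((k : ℂ) - m) * centralCoeff n (k + m) =
      ((m : ℂ) - n) * centralCoeff (m + n) k + ((k : ℂ) - n) * centralCoeff m (k + n) := by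
  unfold centralCoeff
  by_cases h : n + m + k = 0
  · obtain rfl : k = -n - m := by omega
    rw [if_pos (by omega), if_pos (by omega), if_pos (by omega)]
    push_cast
    ring
  · rw [if_neg (by omega), if_neg (by omega), if_neg (by omega)]
    simp

theorem stdBasis_induction {P : W22 → Prop} (basis : ∀ a, P (stdBasis a))
    (add : ∀ x y, P x → P y → P (x + y)) (smul : ∀ (c : ℂ) x, P x → P (c • x)) (x : W22) :
    P x := by
  have hx : x ∈ Submodule.span ℂ (Set.range stdBasis) := by
    rw [stdBasis.span_eq]; exact Submodule.mem_top
  induction hx using Submodule.span_induction with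
  | mem x h => obtain ⟨a, rfl⟩ := h; exact basis a
  | zero => simpa using smul 0 _ (basis Gen.z)
  | add x y _ _ h h' => exact add x y h h'
  | smul c x _ h => exact smul c x h

theorem bracketMap_leibniz (x y t : W22) :
    bracketMap x (bracketMap y t) =
      bracketMap (bracketMap x y) t + bracketMap y (bracketMap x t) := by
  induction x using stdBasis_induction with
  | add x x' hx hx' => simp only [map_add, LinearMap.add_apply, hx, hx']; abel
  | smul c x hx => simp only [map_smul, LinearMap.smul_apply, hx, smul_add]
  | basis a =>
  induction y using stdBasis_induction with
  | add y y' hy hy' => simp only [map_add, LinearMap.add_apply, hy, hy']; abel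
  | smul c y hy => simp only [map_smul, LinearMap.smul_apply, hy, smul_add]
  | basis b =>
  induction t using stdBasis_induction with
  | add t t' ht ht' => simp only [map_add, ht, ht']; abel
  | smul c t ht => simp only [map_smul, ht, smul_add]
  | basis d =>
  cases a with
  | z => simp [stdBasis_z, bracketMap_z_left]
  | L n =>
    cases b with
    | z => simp [stdBasis_z, bracketMap_z_left, bracketMap_z_right]
    | L m =>
      cases d with
      | z => simp [stdBasis_z, bracketMap_z_right]
      | L k =>
        simp only [stdBasis_L, bracketMap_LL, map_add, map_smul, LinearMap.add_apply,
          LinearMap.smul_apply, bracketMap_z_left, bracketMap_z_right, smul_zero, add_zero]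
        rw [show k + m + n = n + m + k by ring, show k + (m + n) = n + m + k by ring,
          show k + n + m = n + m + k by ring]
        push_cast
        linear_combination (norm := module) centralCoeff_cocycle n m k • z
      | W k =>
        simp only [stdBasis_L, stdBasis_W, bracketMap_LL, bracketMap_LW, map_add, map_smul,
          LinearMap.add_apply, LinearMap.smul_apply, bracketMap_z_left, bracketMap_z_right,
          smul_zero, add_zero]
        rw [show k + m + n = n + m + k by ring, show k + (m + n) = n + m + k by ring,
          show k + n + m = n + m + k by ring]
        push_cast
        linear_combination (norm := module) centralCoeff_cocycle n m k • z
    | W m =>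
      cases d with
      | z => simp [stdBasis_z, bracketMap_z_right]
      | L k =>
        simp only [stdBasis_L, stdBasis_W, bracketMap_LL, bracketMap_LW, bracketMap_WL, map_add, map_smul,
          map_neg, LinearMap.add_apply, LinearMap.smul_apply, bracketMap_z_left,
          bracketMap_z_right, smul_zero, add_zero]
        rw [show m + k + n = n + m + k by ring, show m + n + k = n + m + k by ring,
          show m + (k + n) = n + m + k by ring]
        push_cast
        linear_combination (norm := module) -(centralCoeff_cocycle n k m • z)
      | W k =>
        simp [stdBasis_L, stdBasis_W, bracketMap_WW, bracketMap_LW, bracketMap_z_left, bracketMap_z_right]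
  | W n =>
    cases b with
    | z => simp [stdBasis_z, bracketMap_z_left, bracketMap_z_right]
    | L m =>
      cases d with
      | z => simp [stdBasis_z, bracketMap_z_right]
      | L k =>
        simp only [stdBasis_L, stdBasis_W, bracketMap_LL, bracketMap_LW, bracketMap_WL, map_add, map_smul,
          map_neg, LinearMap.add_apply, LinearMap.smul_apply, LinearMap.neg_apply,
          bracketMap_z_left, bracketMap_z_right, smul_zero, add_zero]
        rw [add_comm k m, show n + (m + k) = n + m + k by ring, show n + k + m = n + m + k by ring]
        push_cast
        linear_combination (norm := module) -(centralCoeff_cocycle k m n • z)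
      | W k =>
        simp [stdBasis_L, stdBasis_W, bracketMap_WW, bracketMap_WL, bracketMap_LW, bracketMap_z_left,
          bracketMap_z_right]
    | W m =>
      cases d with
      | z => simp [stdBasis_z, bracketMap_z_right]
      | L k => simp [stdBasis_L, stdBasis_W, bracketMap_WW, bracketMap_WL, bracketMap_z_right]
      | W k => simp [stdBasis_W, bracketMap_WW]

noncomputable instance : LieRing W22 where
  add_lie x y t := by simp [bracket_def]
  lie_add x y t := by simp [bracket_def]
  lie_self x := by
    have h : (2 : ℂ) • bracketMap x x = 0 := by
      rw [two_smul]
      nth_rewrite 1 [bracketMap_skew x x]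
      exact neg_add_cancel _
    exact (smul_eq_zero.mp h).resolve_left two_ne_zero
  leibniz_lie x y t := bracketMap_leibniz x y t

noncomputable instance : LieAlgebra ℂ W22 where
  lie_smul c x y := by simp [bracket_def]

/-- The subalgebra `W(2,2)₊`, the span of all `L n` and `W n` with `n > 0`. -/
noncomputable def plus : LieSubalgebra ℂ W22 where
  toSubmodule := Submodule.span ℂ {x | ∃ n : ℤ, 0 < n ∧ (x = L n ∨ x = W n)}
  lie_mem' := by
    intro x y hx hy
    change bracketMap x y ∈ Submodule.span ℂ _
    have hc : ∀ n m : ℤ, 0 < n → 0 < m → centralCoeff n m = 0 := fun n m hn hm =>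
      if_neg (by omega)
    induction hx using Submodule.span_induction with
    | zero => rw [map_zero, LinearMap.zero_apply]; exact Submodule.zero_mem _
    | add x x' _ _ h h' => rw [map_add, LinearMap.add_apply]; exact Submodule.add_mem _ h h'
    | smul c x _ h => rw [map_smul, LinearMap.smul_apply]; exact Submodule.smul_mem _ c h
    | mem x hx =>
    induction hy using Submodule.span_induction with
    | zero => rw [map_zero]; exact Submodule.zero_mem _
    | add y y' _ _ h h' => rw [map_add]; exact Submodule.add_mem _ h h'
    | smul c y _ h => rw [map_smul]; exact Submodule.smul_mem _ c h
    | mem y hy =>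
    obtain ⟨n, hn, rfl | rfl⟩ := hx <;> obtain ⟨m, hm, rfl | rfl⟩ := hy
    · rw [bracketMap_LL, hc n m hn hm, zero_smul, add_zero]
      exact Submodule.smul_mem _ _ (Submodule.subset_span ⟨m + n, by omega, Or.inl rfl⟩)
    · rw [bracketMap_LW, hc n m hn hm, zero_smul, add_zero]
      exact Submodule.smul_mem _ _ (Submodule.subset_span ⟨m + n, by omega, Or.inr rfl⟩)
    · rw [bracketMap_WL, hc m n hm hn, zero_smul, add_zero]
      exact Submodule.neg_mem _
        (Submodule.smul_mem _ _ (Submodule.subset_span ⟨n + m, by omega, Or.inr rfl⟩))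
    · rw [bracketMap_WW]
      exact Submodule.zero_mem _

attribute [local instance] LieRing.ofAssociativeRing

theorem L_mem_plus {n : ℤ} (hn : 0 < n) : L n ∈ plus :=
  Submodule.subset_span ⟨n, hn, Or.inl rfl⟩

theorem W_mem_plus {n : ℤ} (hn : 0 < n) : W n ∈ plus :=
  Submodule.subset_span ⟨n, hn, Or.inr rfl⟩

/-- A Lie algebra homomorphism `φ : W(2,2)₊ → ℂ` is non-singular if
`φ (L i) * φ (W i) ≠ 0` for `i = 1, 2`. -/
def NonSingular (φ : LieAlgebra.LieCharacter ℂ plus) : Prop :=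
  φ ⟨L 1, L_mem_plus one_pos⟩ * φ ⟨W 1, W_mem_plus one_pos⟩ ≠ 0 ∧
  φ ⟨L 2, L_mem_plus two_pos⟩ * φ ⟨W 2, W_mem_plus two_pos⟩ ≠ 0

/-- The universal enveloping algebra of `W(2,2)`. A `W(2,2)`-module is a module over it. -/
abbrev U : Type := UniversalEnvelopingAlgebra ℂ W22

/-- The universal enveloping algebra of `W(2,2)₊`. -/
abbrev UPlus : Type := UniversalEnvelopingAlgebra ℂ plus

/-- The canonical map `W(2,2) → U(W(2,2))`. -/
noncomputable abbrev toU (x : W22) : U := UniversalEnvelopingAlgebra.ι ℂ x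

/-- The homomorphism `U(W(2,2)₊) → U(W(2,2))` induced by the inclusion. It makes `U(W(2,2))` a
right `U(W(2,2)₊)`-module. -/
noncomputable def inclU : UPlus →ₐ[ℂ] U :=
  UniversalEnvelopingAlgebra.lift ℂ ((UniversalEnvelopingAlgebra.ι ℂ).comp plus.incl)

/-- A vector `v` of a `W(2,2)`-module is a Whittaker vector (of type `φ`) if `x v = φ(x) v` for
all `x ∈ W(2,2)₊`. -/
def IsWhittakerVector (φ : LieAlgebra.LieCharacter ℂ plus) {V : Type*} [AddCommGroup V] [Module ℂ V] [Module U V]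
    [IsScalarTower ℂ U V] (v : V) : Prop :=
  ∀ x : plus, toU (x : W22) • v = φ x • v

/-- The one-dimensional `W(2,2)₊`-module `ℂ_φ` on which `x` acts as the scalar `φ x`. -/
def OneDim (_φ : LieAlgebra.LieCharacter ℂ plus) : Type := ℂ

noncomputable instance (φ : LieAlgebra.LieCharacter ℂ plus) : AddCommGroup (OneDim φ) :=
  inferInstanceAs (AddCommGroup ℂ)

noncomputable instance (φ : LieAlgebra.LieCharacter ℂ plus) : Module ℂ (OneDim φ) :=
  inferInstanceAs (Module ℂ ℂ)

noncomputable instance (φ : LieAlgebra.LieCharacter ℂ plus) : Module UPlus (OneDim φ) :=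
  Module.compHom ℂ (UniversalEnvelopingAlgebra.lift ℂ φ : UPlus →ₐ[ℂ] ℂ).toRingHom

/-- The element `1` of `ℂ_φ`. -/
noncomputable def oneDimOne (φ : LieAlgebra.LieCharacter ℂ plus) : OneDim φ := (1 : ℂ)

theorem ι_smul_oneDim (φ : LieAlgebra.LieCharacter ℂ plus) (x : plus) (c : OneDim φ) :
    (UniversalEnvelopingAlgebra.ι ℂ x : UPlus) • c = φ x • c :=
  congrArg (fun a : ℂ => HMul.hMul (α := ℂ) (β := ℂ) a c)
    (UniversalEnvelopingAlgebra.lift_ι_apply ℂ φ x)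

/-- The relations `u a ⊗ c = u ⊗ a c` with `a ∈ U(W(2,2)₊)`. -/
noncomputable def balancing (φ : LieAlgebra.LieCharacter ℂ plus) : Submodule U (U ⊗[ℂ] OneDim φ) :=
  Submodule.span U {t | ∃ (u : U) (a : UPlus) (c : OneDim φ),
    t = (u * inclU a) ⊗ₜ[ℂ] c - u ⊗ₜ[ℂ] (a • c)}

/-- The induced module `M_φ = U(W(2,2)) ⊗_{U(W(2,2)₊)} ℂ_φ`. As Mathlib has tensor products over
commutative rings only, it is the tensor product over `ℂ` modulo the balancing relations. -/
abbrev M (φ : LieAlgebra.LieCharacter ℂ plus) : Type := (U ⊗[ℂ] OneDim φ) ⧸ balancing φ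

/-- The cyclic Whittaker vector `w = 1 ⊗ 1` of `M_φ`. -/
noncomputable def w (φ : LieAlgebra.LieCharacter ℂ plus) : M φ :=
  Submodule.Quotient.mk ((1 : U) ⊗ₜ[ℂ] oneDimOne φ)

/-- `z` is central in `U(W(2,2))`. -/
theorem commute_toU_z (u : U) : Commute (toU z) u := by
  obtain ⟨t, rfl⟩ : ∃ t, UniversalEnvelopingAlgebra.mkAlgHom ℂ W22 t = u :=
    RingCon.mkₐ_surjective _ u
  induction t using TensorAlgebra.induction with
  | algebraMap c => rw [AlgHom.commutes]; exact (Algebra.commutes c _).symm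
  | ι x =>
    have h : ⁅toU z, toU x⁆ = 0 := by
      rw [← LieHom.map_lie, bracket_def, bracketMap_z_left, map_zero]
    rw [LieRing.of_associative_ring_bracket, sub_eq_zero] at h
    exact h
  | mul a b ha hb => rw [map_mul]; exact ha.mul_right hb
  | add a b ha hb => rw [map_add]; exact ha.add_right hb

/-- The submodule `(z - ξ) M_φ` of `M_φ`. -/
noncomputable def zSub (φ : LieAlgebra.LieCharacter ℂ plus) (ξ : ℂ) : Submodule U (M φ) where
  carrier := Set.range fun m : M φ => (toU z - algebraMap ℂ U ξ) • m
  add_mem' := by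
    rintro _ _ ⟨a, rfl⟩ ⟨b, rfl⟩
    exact ⟨a + b, smul_add _ _ _⟩
  zero_mem' := ⟨0, smul_zero _⟩
  smul_mem' := by
    rintro u _ ⟨a, rfl⟩
    refine ⟨u • a, ?_⟩
    have h : Commute (toU z - algebraMap ℂ U ξ) u :=
      (commute_toU_z u).sub_left (Algebra.commutes ξ u)
    simp only [smul_smul, h.eq]

/-- The quotient module `L_{φ,ξ} = M_φ / (z - ξ) M_φ`. -/
abbrev LQuot (φ : LieAlgebra.LieCharacter ℂ plus) (ξ : ℂ) : Type := M φ ⧸ zSub φ ξ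

/-- The image of `w` in `L_{φ,ξ}`. -/
noncomputable def wBar (φ : LieAlgebra.LieCharacter ℂ plus) (ξ : ℂ) : LQuot φ ξ := Submodule.Quotient.mk (w φ)

/-- A non-positive partition: a finite (possibly empty) non-decreasing sequence of non-positive
integers. -/
@[ext]
structure NonposPartition where
  /-- The sequence of the parts. -/
  parts : List ℤ
  sorted : parts.Pairwise (· ≤ ·)
  nonpos : ∀ i ∈ parts, i ≤ 0

/-- `L_λ = L_{λ_1} L_{λ_2} ⋯ L_{λ_r}` in the universal enveloping algebra. -/
noncomputable def LMon (l : NonposPartition) : U := (l.parts.map fun i => toU (L i)).prod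

/-- `W_μ = W_{μ_1} W_{μ_2} ⋯ W_{μ_r}` in the universal enveloping algebra. -/
noncomputable def WMon (l : NonposPartition) : U := (l.parts.map fun i => toU (W i)).prod

end W22

/-! Basis. Order the letters as `L n`, then `W n` with `n ≤ 0`, and after them the letters acting on
the cyclic vector by scalars: `L n`, `W n` with `n > 0`, and `z`. Sorting a word by the commutation
relations and absorbing scalar letters at its right end shows that the monomials span. For
independence, the same rewriting defines a function `normalForm` from words to the free vector space
on words. Rewriting is confluent: overlapping descents are reconciled by the Jacobi identity, and
the scalar rule is consistent because a character kills brackets (`diamond`, `commutes_normalForm`).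
Hence `normalForm` is a Whittaker vector, with `z` acting as `ξ`, in the module of functions on
words that respect the relations. The universal property of `LQuot` maps `wBar` to it, and
evaluation at the empty word sends the monomials to distinct basis vectors.

Whittaker vectors. Since `W n` is a multiple of `⁅L 1, W (n - 1)⁆` for `n ≥ 3`, `φ` kills it, while
`φ (W 2) ≠ 0`. Suppose that a Whittaker vector involves letters `L`. Among its monomials with the
most letters `L`, let `m` be the least first index. Commuting `W (2 - m)` past `L i`, where `i ≥ m`,
creates `W (2 - m + i)`, which to leading order acts as a nonzero scalar only for `i = m`. So `W (2
- m) - φ (W (2 - m))` deletes one `L m` with a nonzero coefficient, up to terms with fewer letters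
`L` (`W_smul_vec_leading`). Deleting `m` is injective on the relevant monomials, so nothing cancels,
a contradiction. Only letters `W` remain; `L (2 - m)` removes these in the same way, now without
error terms (`L_smul_vec_nil`). -/

namespace Straightening

/-! ### Words, inversions and the termination order -/

section Inversions

variable {ι : Type*} [LinearOrder ι]

/-- The number of inversions of a word. -/
def inversions : List ι → ℕ
  | [] => 0
  | i :: l => l.countP (· < i) + inversions l

theorem inversions_swap {i j : ι} (h : j < i) (a b : List ι) :
    inversions (a ++ i :: j :: b) = inversions (a ++ j :: i :: b) + 1 := by
  induction a with
  | nil => simp [inversions, h, h.not_gt]; omega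
  | cons c a ih =>
    have hp : (a ++ i :: j :: b).countP (· < c) = (a ++ j :: i :: b).countP (· < c) :=
      (List.Perm.append_left a (List.Perm.swap j i b)).countP_eq _
    simp only [List.cons_append, inversions, ih, hp]
    omega

theorem exists_descent {w : List ι} (h : ¬ w.Pairwise (· ≤ ·)) :
    ∃ a i j b, j < i ∧ w = a ++ i :: j :: b := by
  rw [← List.isChain_iff_pairwise] at h
  induction w with
  | nil => simp at h
  | cons i w ih =>
    cases w with
    | nil => simp at h
    | cons j w =>
      rw [List.isChain_cons_cons, not_and_or] at h
      rcases h with h | h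
      · exact ⟨[], i, j, w, not_le.mp h, rfl⟩
      · obtain ⟨a, i', j', b, hij, e⟩ := ih h
        exact ⟨i :: a, i', j', b, hij, by rw [e]; rfl⟩

/-- Words are compared by length, then by number of inversions. -/
def Smaller : List ι → List ι → Prop :=
  InvImage (Prod.Lex (· < ·) (· < ·)) fun w => (w.length, inversions w)

theorem wellFounded_smaller : WellFounded (Smaller (ι := ι)) :=
  InvImage.wf _ (WellFounded.prod_lex wellFounded_lt wellFounded_lt)

theorem smaller_of_length {w w' : List ι} (h : w.length < w'.length) : Smaller w w' :=
  Prod.Lex.left _ _ h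

theorem smaller_swap {i j : ι} (h : j < i) (a b : List ι) :
    Smaller (a ++ j :: i :: b) (a ++ i :: j :: b) := by
  change Prod.Lex _ _ (_, _) (_, _)
  rw [show (a ++ j :: i :: b).length = (a ++ i :: j :: b).length by simp, inversions_swap h]
  exact Prod.Lex.right _ (Nat.lt_succ_self _)

theorem Smaller.trans {u v w : List ι} (h₁ : Smaller u v) (h₂ : Smaller v w) : Smaller u w :=
  Trans.trans (r := Prod.Lex (· < ·) (· < ·)) (s := Prod.Lex (· < ·) (· < ·)) h₁ h₂

end Inversions

/-! ### Commutation relations on functions of words, and confluence -/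

variable {ι k g V : Type*} [CommRing k] [LieRing g] [LieAlgebra k g]
  [AddCommGroup V] [Module k V]

/-- The value of `N` on the sum of words `u x v`, with the vector `x` expanded in a basis. -/
noncomputable def insertVec (B : Module.Basis ι k g) (N : List ι → V) (u v : List ι) : g →ₗ[k] V :=
  B.constr k fun i => N (u ++ i :: v)

@[simp] theorem insertVec_basis (B : Module.Basis ι k g) (N : List ι → V) (u v : List ι) (i : ι) :
    insertVec B N u v (B i) = N (u ++ i :: v) := by
  simp [insertVec]

variable (B : Module.Basis ι k g)

/-- `N` respects the commutation relation at a given position. -/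
def Commutes (N : List ι → V) (a : List ι) (i j : ι) (b : List ι) : Prop :=
  N (a ++ i :: j :: b) = N (a ++ j :: i :: b) + insertVec B N a b ⁅B i, B j⁆

variable {B} in
theorem Commutes.symm {N : List ι → V} {a b : List ι} {i j : ι} (h : Commutes B N a i j b) :
    Commutes B N a j i b := by
  unfold Commutes at *
  rw [h, ← lie_skew, map_neg]
  abel

theorem commutes_self (N : List ι → V) (a b : List ι) (i : ι) : Commutes B N a i i b := by
  simp [Commutes]

/-- The commutation relation of a vector with a letter. -/
theorem insertVec_comm {N : List ι → V} {a b : List ι} {j : ι}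
    (h : ∀ i, Commutes B N a i j b) (x : g) :
    insertVec B N a (j :: b) x = insertVec B N (a ++ [j]) b x + insertVec B N a b ⁅x, B j⁆ := by
  have : insertVec B N a (j :: b) = insertVec B N (a ++ [j]) b +
      insertVec B N a b ∘ₗ (-(LieAlgebra.ad k g (B j) : g →ₗ[k] g)) := by
    refine B.ext fun i => ?_
    have := h i
    simp only [Commutes] at this
    rw [LinearMap.add_apply, LinearMap.comp_apply, LinearMap.neg_apply]
    change _ = _ + insertVec B N a b (-⁅B j, B i⁆)
    rw [lie_skew]
    simpa using this
  rw [this, LinearMap.add_apply, LinearMap.comp_apply, LinearMap.neg_apply]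
  change _ + insertVec B N a b (-⁅B j, x⁆) = _
  rw [lie_skew]

/-- Insertions of two vectors, at different places, can be done in either order. -/
theorem constr_insertVec_comm (N : List ι → V) (a c b : List ι) (x y : g) :
    B.constr k (fun s => insertVec B N (a ++ s :: c) b y) x =
      B.constr k (fun t => insertVec B N a (c ++ t :: b) x) y := by
  let f : g →ₗ[k] g →ₗ[k] V := B.constr k fun s => insertVec B N (a ++ s :: c) b
  let f' : g →ₗ[k] g →ₗ[k] V := B.constr k fun t => insertVec B N a (c ++ t :: b)
  have h : f = f'.flip := B.ext fun s => B.ext fun t => by simp [f, f']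
  have h₁ : B.constr k (fun s => insertVec B N (a ++ s :: c) b y) = f.flip y :=
    B.ext fun s => by simp [f]
  have h₂ : B.constr k (fun t => insertVec B N a (c ++ t :: b) x) = f'.flip x :=
    B.ext fun s => by simp [f']
  rw [h₁, h₂, h]
  rfl

/-- Both sides are linear in `x`, so the relation for each inserted letter suffices. With its mirror
image it settles the case of disjoint descents. -/
theorem insertVec_comm_right {N : List ι → V} {a c b : List ι} {i j : ι}
    (h : ∀ s, Commutes B N (a ++ s :: c) i j b) (x : g) :
    insertVec B N a (c ++ i :: j :: b) x = insertVec B N a (c ++ j :: i :: b) x +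
      B.constr k (fun s => insertVec B N (a ++ s :: c) b ⁅B i, B j⁆) x := by
  rw [← LinearMap.add_apply]
  congr 1
  exact B.ext fun s => by simpa [Commutes] using h s

theorem insertVec_comm_left {N : List ι → V} {a c b : List ι} {i j : ι}
    (h : ∀ s, Commutes B N a i j (c ++ s :: b)) (x : g) :
    insertVec B N (a ++ i :: j :: c) b x = insertVec B N (a ++ j :: i :: c) b x +
      B.constr k (fun s => insertVec B N a (c ++ s :: b) ⁅B i, B j⁆) x := by
  rw [← LinearMap.add_apply]
  congr 1
  exact B.ext fun s => by simpa [Commutes] using h s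

variable [LinearOrder ι]

/-- The relation is symmetric in the two letters by antisymmetry of the bracket, and trivial for
equal letters. -/
theorem commutes_of_descents {N : List ι → V} {a b : List ι}
    (h : ∀ i j, j < i → Commutes B N a i j b) (i j : ι) : Commutes B N a i j b := by
  rcases lt_trichotomy i j with hij | rfl | hij
  · exact (h j i hij).symm
  · exact commutes_self B N a b i
  · exact h i j hij

/-- The diamond lemma: two ways to resolve a descent agree if the relations hold for all smaller
words. -/
theorem diamond {N : List ι → V} {a b a' b' : List ι} {i j i' j' : ι} (hij : j < i)
    (hij' : j' < i') (e : a ++ i :: j :: b = a' ++ i' :: j' :: b') (hle : a.length ≤ a'.length)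
    (IH : ∀ c s t d, t < s → Smaller (c ++ s :: t :: d) (a ++ i :: j :: b) →
      Commutes B N c s t d) :
    N (a ++ j :: i :: b) + insertVec B N a b ⁅B i, B j⁆ =
      N (a' ++ j' :: i' :: b') + insertVec B N a' b' ⁅B i', B j'⁆ := by
  obtain ⟨c, rfl⟩ : ∃ c, a' = a ++ c := by
    have := List.prefix_of_prefix_length_le (l₃ := a ++ i :: j :: b) ⟨_, rfl⟩ ⟨_, e.symm⟩ hle
    exact ⟨_, this.choose_spec.symm⟩
  -- For strictly shorter words the relation holds for any pair of letters, since length alone makes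
  -- them smaller.
  have short : ∀ c s t d, (c ++ s :: t :: d).length < (a ++ i :: j :: b).length →
      Commutes B N c s t d := fun c s t d hl =>
    commutes_of_descents B (fun s t hst => IH c s t d hst (smaller_of_length (by simpa using hl)))
      s t
  rw [List.append_assoc, List.append_cancel_left_eq] at e
  match c, e with
  | [], e =>
    simp only [List.nil_append, List.cons.injEq] at e
    obtain ⟨rfl, rfl, rfl⟩ := e
    simp
  -- Overlap: three letters `i > j > j'`. Both resolutions are continued down to the word with `j' j
  -- i`; the bracket terms left over differ by the Jacobi identity.
  | [c], e =>
    simp only [List.cons_append, List.nil_append, List.cons.injEq] at e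
    obtain ⟨rfl, rfl, rfl⟩ := e
    have s₁ := smaller_swap hij a (j' :: b')
    have s₂ := smaller_swap hij' (a ++ [i]) b'
    simp only [List.append_assoc, List.cons_append, List.nil_append] at s₁ s₂
    have hik := hij'.trans hij
    have e₁ := IH (a ++ [j]) i j' b' hik (by simpa using s₁)
    have t₁ := smaller_swap hik (a ++ [j]) b'
    have e₂ := IH a j j' (i :: b') hij' (Smaller.trans (by simpa using t₁) s₁)
    have e₃ := IH a i j' (j :: b') hik (by simpa using s₂)
    have t₃ := smaller_swap hik a (j :: b')
    have e₄ := IH (a ++ [j']) i j b' hij (Smaller.trans (by simpa using t₃) s₂)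
    have f₁ := insertVec_comm B (N := N) (a := a) (b := b') (j := i)
      (fun s => short _ _ _ _ (by simp)) ⁅B j, B j'⁆
    have f₂ := insertVec_comm B (N := N) (a := a) (b := b') (j := j)
      (fun s => short _ _ _ _ (by simp)) ⁅B i, B j'⁆
    have f₃ := insertVec_comm B (N := N) (a := a) (b := b') (j := j')
      (fun s => short _ _ _ _ (by simp)) ⁅B i, B j⁆
    have jac : ⁅⁅B j, B j'⁆, B i⁆ - ⁅⁅B i, B j'⁆, B j⁆ + ⁅⁅B i, B j⁆, B j'⁆ = 0 := by
      have h := lie_jacobi (B i) (B j) (B j')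
      rw [← lie_skew (B i) ⁅B j, B j'⁆, ← lie_skew (B j') ⁅B i, B j⁆, ← lie_skew (B j') (B i),
        lie_neg, lie_skew, ← neg_eq_zero] at h
      rw [← h, ← lie_skew ⁅B j, B j'⁆ (B i), ← lie_skew ⁅B i, B j'⁆ (B j)]
      abel
    have jac' := congrArg (insertVec B N a b') jac
    simp only [map_add, map_sub, map_zero] at jac'
    simp only [Commutes, List.append_assoc, List.cons_append, List.nil_append] at *
    rw [e₁, e₂, e₃, e₄, f₁, f₃]
    rw [f₂]
    linear_combination (norm := abel) jac'
  -- Disjoint descents: each is resolved after the other, and the two bracket insertions commute.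
  | c₁ :: c₂ :: c, e =>
    simp only [List.cons_append, List.cons.injEq] at e
    obtain ⟨rfl, rfl, rfl⟩ := e
    have s₁ := smaller_swap hij a (c ++ i' :: j' :: b')
    have s₂ := smaller_swap hij' (a ++ i :: j :: c) b'
    have e₁ := IH (a ++ j :: i :: c) i' j' b' hij' (by simpa using s₁)
    have e₂ := IH a i j (c ++ j' :: i' :: b') hij (by simpa using s₂)
    have f₁ := insertVec_comm_right B (N := N) (a := a) (b := b') (c := c) (i := i') (j := j')
      (fun s => short _ _ _ _ (by simp)) ⁅B i, B j⁆
    have f₂ := insertVec_comm_left B (N := N) (a := a) (b := b') (c := c) (i := i) (j := j)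
      (fun s => short _ _ _ _ (by simp)) ⁅B i', B j'⁆
    rw [constr_insertVec_comm] at f₁
    simp only [Commutes, List.append_assoc, List.cons_append] at *
    rw [e₁, e₂, f₁, f₂]
    abel

/-! ### The normal form of a word -/

section NormalForm

variable (P : ι → Prop) (χ : g →ₗ[k] k) (F : List ι → V)

open Classical in
/-- Evaluation of words in the basis of a Lie algebra: a last letter in `P` acts as a scalar, a
descent is rewritten with the commutation relations, and the other words have the values `F`. -/
noncomputable def normalForm (w : List ι) : V :=
  if hP : ∃ d : List ι × ι, P d.2 ∧ w = d.1 ++ [d.2] then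
    have : Smaller hP.choose.1 w := smaller_of_length <| by
      conv_rhs => rw [hP.choose_spec.2]
      simp
    χ (B hP.choose.2) • normalForm hP.choose.1
  else if hd : ∃ d : List ι × ι × ι × List ι,
      d.2.2.1 < d.2.1 ∧ w = d.1 ++ d.2.1 :: d.2.2.1 :: d.2.2.2 then
    have h₁ : Smaller (hd.choose.1 ++ hd.choose.2.2.1 :: hd.choose.2.1 :: hd.choose.2.2.2) w := by
      conv_rhs => rw [hd.choose_spec.2]
      exact smaller_swap hd.choose_spec.1 _ _
    have h₂ : ∀ i, Smaller (hd.choose.1 ++ i :: hd.choose.2.2.2) w := fun i =>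
      smaller_of_length <| by
        conv_rhs => rw [hd.choose_spec.2]
        simp
    normalForm (hd.choose.1 ++ hd.choose.2.2.1 :: hd.choose.2.1 :: hd.choose.2.2.2) +
      B.constr k (fun i => normalForm (hd.choose.1 ++ i :: hd.choose.2.2.2))
        ⁅B hd.choose.2.1, B hd.choose.2.2.1⁆
  else F w
termination_by wellFounded_smaller.wrap w
decreasing_by all_goals first | exact this | exact h₁ | exact h₂ _

/-- A word determines its last letter and the preceding prefix, so the choice made in the first
clause of the recursion is forced. -/
theorem normalForm_concat {i : ι} (hi : P i) (w : List ι) :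
    normalForm B P χ F (w ++ [i]) = χ (B i) • normalForm B P χ F w := by
  have h : ∃ d : List ι × ι, P d.2 ∧ w ++ [i] = d.1 ++ [d.2] := ⟨(w, i), hi, rfl⟩
  rw [normalForm, dif_pos h]
  obtain ⟨h₁, h₂⟩ := List.append_inj' h.choose_spec.2 rfl
  have h₃ := List.singleton_injective h₂
  change χ (B h.choose.2) • normalForm B P χ F h.choose.1 = _
  generalize h.choose.1 = u at *
  generalize h.choose.2 = v at *
  subst h₁ h₃
  rfl

theorem normalForm_sorted {w : List ι} (hw : w.Pairwise (· ≤ ·)) (hP : ∀ i ∈ w, ¬ P i) :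
    normalForm B P χ F w = F w := by
  rw [normalForm, dif_neg, dif_neg]
  · rintro ⟨⟨a, i, j, b⟩, hij, rfl⟩
    simp only [List.pairwise_append, List.pairwise_cons] at hw
    exact absurd (hw.2.1.1 j (by simp)) hij.not_ge
  · rintro ⟨⟨a, i⟩, hi, rfl⟩
    exact hP i (by simp) hi

/-- The recursion resolves one unspecified descent; that every other descent gives the same value is
the content of confluence. -/
theorem normalForm_descent {w : List ι} (hP : ∀ a i, P i → w ≠ a ++ [i])
    (hd : ¬ w.Pairwise (· ≤ ·)) :
    ∃ a i j b, j < i ∧ w = a ++ i :: j :: b ∧ normalForm B P χ F w =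
      normalForm B P χ F (a ++ j :: i :: b) +
        insertVec B (normalForm B P χ F) a b ⁅B i, B j⁆ := by
  have h : ∃ d : List ι × ι × ι × List ι,
      d.2.2.1 < d.2.1 ∧ w = d.1 ++ d.2.1 :: d.2.2.1 :: d.2.2.2 := by
    obtain ⟨a, i, j, b, hij, e⟩ := exists_descent hd
    exact ⟨(a, i, j, b), hij, e⟩
  refine ⟨h.choose.1, h.choose.2.1, h.choose.2.2.1, h.choose.2.2.2, h.choose_spec.1,
    h.choose_spec.2, ?_⟩
  rw [normalForm, dif_neg (fun ⟨d, h₁, h₂⟩ => hP d.1 d.2 h₁ h₂), dif_pos h]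
  rfl

end NormalForm

/-! ### Independence of the rewriting choices -/

section Correctness

variable {P : ι → Prop} {χ : g →ₗ[k] k} (F : List ι → V)

/-- `normalForm` respects all commutation relations. -/
theorem commutes_normalForm (hP : ∀ i j, i ≤ j → P i → P j)
    (hlie : ∀ i j, P i → P j → ⁅B i, B j⁆ ∈ Submodule.span k (B '' {i | P i}))
    (hχ : ∀ i j, P i → P j → χ ⁅B i, B j⁆ = 0) (a : List ι) (i j : ι) (b : List ι) :
    Commutes B (normalForm B P χ F) a i j b := by
  suffices H : ∀ w : List ι, ∀ a i j b, j < i → w = a ++ i :: j :: b →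
      Commutes B (normalForm B P χ F) a i j b from
    commutes_of_descents B (fun i j hij => H _ a i j b hij rfl) i j
  intro w
  refine wellFounded_smaller.induction (C := fun w : List ι => ∀ a i j b, j < i →
    w = a ++ i :: j :: b → Commutes B (normalForm B P χ F) a i j b) w fun w IH => ?_
  rintro a i j b hij rfl
  have concat : ∀ u s, P s → insertVec B (normalForm B P χ F) a (u ++ [s]) =
      χ (B s) • insertVec B (normalForm B P χ F) a u := fun u s hs => B.ext fun t => by
    have := normalForm_concat B P χ F hs (a ++ t :: u)
    simpa using this
  by_cases hlast : ∃ c s, P s ∧ a ++ i :: j :: b = c ++ [s]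
  · obtain ⟨c, s, hs, e⟩ := hlast
    -- If the descent is itself at the end, then `j` is in `P`, hence so is the larger `i`: both
    -- orders give the same product of scalars, and the bracket contributes `χ ⁅B i, B j⁆ = 0`.
    -- Otherwise the last letter factors out as a scalar and the shorter word is used.
    rcases List.eq_nil_or_concat' b with rfl | ⟨b, s', rfl⟩
    · obtain ⟨rfl, h⟩ := List.append_inj' (s₁ := a ++ [i]) (t₁ := [j])
        (s₂ := c) (t₂ := [s]) (by simpa using e) rfl
      obtain rfl := List.singleton_injective h
      have hi := hP _ _ hij.le hs
      have key : ∀ x ∈ Submodule.span k (B '' {i | P i}),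
          insertVec B (normalForm B P χ F) a [] x = χ x • normalForm B P χ F a := by
        intro x hx
        induction hx using Submodule.span_induction with
        | mem x hx =>
          obtain ⟨t, ht, rfl⟩ := hx
          rw [insertVec_basis, normalForm_concat B P χ F ht]
        | zero => simp
        | add x y _ _ hx hy => rw [map_add, map_add, hx, hy, add_smul]
        | smul c x _ hx => rw [map_smul, map_smul, hx, smul_assoc]
      have e₁ := normalForm_concat B P χ F hs (a ++ [i])
      have e₂ := normalForm_concat B P χ F hi (a ++ [j])
      rw [normalForm_concat B P χ F hi] at e₁
      rw [normalForm_concat B P χ F hs] at e₂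
      simp only [List.append_assoc, List.cons_append, List.nil_append] at e₁ e₂
      rw [Commutes, e₁, e₂, key _ (hlie _ _ hi hs), hχ _ _ hi hs, zero_smul, add_zero,
        smul_comm]
    · obtain ⟨rfl, h⟩ := List.append_inj' (s₁ := a ++ i :: j :: b) (t₁ := [s']) (s₂ := c)
        (t₂ := [s]) (by simpa using e) rfl
      obtain rfl := List.singleton_injective h
      have h := IH (a ++ i :: j :: b) (smaller_of_length (by simp)) a i j b hij rfl
      have e₁ := normalForm_concat B P χ F hs (a ++ i :: j :: b)
      have e₂ := normalForm_concat B P χ F hs (a ++ j :: i :: b)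
      simp only [List.append_assoc, List.cons_append] at e₁ e₂
      rw [Commutes, e₁, e₂, concat _ _ hs, h, smul_add, LinearMap.smul_apply]
  · obtain ⟨a', i', j', b', hij', e, h⟩ := normalForm_descent B P χ F
      (w := a ++ i :: j :: b) (fun c s hs e => hlast ⟨c, s, hs, e⟩) (fun h => by
        simp only [List.pairwise_append, List.pairwise_cons] at h
        exact hij.not_ge (h.2.1.1 j (by simp)))
    rw [Commutes, h]
    -- The recursion resolved the descent at `a'`; confluence compares it with the one at `a`,
    -- whichever lies further left.
    rcases le_total a.length a'.length with hle | hle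
    · exact (diamond B hij hij' e hle fun c s t d hst hs => IH _ hs c s t d hst rfl).symm
    · exact diamond B hij' hij e.symm hle fun c s t d hst hs => IH _ (e ▸ hs) c s t d hst rfl

end Correctness

end Straightening

namespace Straightening

variable {ι k g V : Type*} [CommRing k] [LieRing g] [LieAlgebra k g]
  [AddCommGroup V] [Module k V] (B : Module.Basis ι k g)

/-! ### Spanning by sorted words -/

section Span

variable [LinearOrder ι] {P : ι → Prop} {χ : ι → k} {N : List ι → V}

/-- Words are spanned by sorted words without letters in `P`, and this respects weights. -/
theorem mem_span_sorted (hP : ∀ i j, i ≤ j → P i → P j)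
    (hN : ∀ a i j b, Commutes B N a i j b) (hχ : ∀ w i, P i → N (w ++ [i]) = χ i • N w)
    (wt : ι → ℕ) (hwt : ∀ i j, ⁅B i, B j⁆ ∈ Submodule.span k (B '' {t | wt t ≤ wt i + wt j}))
    (s : ℕ) (w : List ι) (hw : (w.map wt).sum ≤ s) :
    N w ∈ Submodule.span k
      (N '' {u | u.Pairwise (· ≤ ·) ∧ (∀ i ∈ u, ¬ P i) ∧ (u.map wt).sum ≤ s}) := by
  revert hw
  refine wellFounded_smaller.induction (C := fun w : List ι => (w.map wt).sum ≤ s → N w ∈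
    Submodule.span k (N '' {u | u.Pairwise (· ≤ ·) ∧ (∀ i ∈ u, ¬ P i) ∧ (u.map wt).sum ≤ s}))
    w fun w IH hw => ?_
  by_cases hs : w.Pairwise (· ≤ ·)
  · rcases List.eq_nil_or_concat' w with rfl | ⟨w, i, rfl⟩
    · exact Submodule.subset_span ⟨[], by simp, rfl⟩
    · by_cases hi : P i
      · rw [hχ w i hi]
        refine Submodule.smul_mem _ _ (IH w (smaller_of_length (by simp)) ?_)
        simp only [List.map_append, List.sum_append] at hw
        omega
      · refine Submodule.subset_span ⟨_, ⟨hs, fun j hj hj' => hi (hP j i ?_ hj'), hw⟩, rfl⟩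
        rw [List.mem_append, List.mem_singleton] at hj
        rcases hj with hj | rfl
        · exact (List.pairwise_append.mp hs).2.2 j hj i (by simp)
        · rfl
  · obtain ⟨a, i, j, b, hij, rfl⟩ := exists_descent hs
    rw [hN a i j b]
    simp only [List.map_append, List.map_cons, List.sum_append, List.sum_cons] at hw
    refine Submodule.add_mem _ (IH _ (smaller_swap hij a b) ?_) ?_
    · simp only [List.map_append, List.map_cons, List.sum_append, List.sum_cons]
      omega
    -- The bracket replaces two letters by one without raising the weight, so the correction terms
    -- are shorter words within the same bound.
    · have hij' := hwt i j
      generalize ⁅B i, B j⁆ = y at hij'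
      induction hij' using Submodule.span_induction with
      | mem x hx =>
        obtain ⟨t, ht, rfl⟩ := hx
        rw [insertVec_basis]
        refine IH _ (smaller_of_length (by simp)) ?_
        simp only [Set.mem_ofPred_eq] at ht
        simp only [List.map_append, List.map_cons, List.sum_append, List.sum_cons]
        omega
      | zero => simp
      | add x y _ _ hx hy => rw [map_add]; exact Submodule.add_mem _ hx hy
      | smul c x _ hx => rw [map_smul]; exact Submodule.smul_mem _ c hx

end Span

/-! ### The coinduced module of functions on words -/

section Coinduced

variable (V) in
/-- The functions on words that respect the commutation relations. These are the linear maps from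
the universal enveloping algebra to `V`. -/
def coinduced : Submodule k (List ι → V) where
  carrier := {h | ∀ a i j b, Commutes B h a i j b}
  zero_mem' := fun a i j b => by
    have : insertVec B (0 : List ι → V) a b = 0 := B.ext fun s => by simp
    simp [Commutes, this]
  add_mem' := by
    intro h h' H H' a i j b
    have : insertVec B (h + h') a b = insertVec B h a b + insertVec B h' a b :=
      B.ext fun s => by simp
    rw [Commutes, this, LinearMap.add_apply, Pi.add_apply, Pi.add_apply, H a i j b, H' a i j b]
    abel
  smul_mem' := by
    intro c h H a i j b
    have : insertVec B (c • h) a b = c • insertVec B h a b := B.ext fun s => by simp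
    rw [Commutes, this, LinearMap.smul_apply, Pi.smul_apply, Pi.smul_apply, H a i j b, smul_add]

/-- The action of the Lie algebra on functions on words. -/
noncomputable def shift : g →ₗ[k] Module.End k (coinduced V B) :=
  B.constr k fun s =>
    { toFun := fun h => ⟨fun w => h.1 (w ++ [s]), fun a i j b => by
        have e : insertVec B (fun w => h.1 (w ++ [s])) a b = insertVec B h.1 a (b ++ [s]) :=
          B.ext fun t => by simp
        rw [Commutes, e]
        simpa [Commutes] using h.2 a i j (b ++ [s])⟩
      map_add' := fun _ _ => rfl
      map_smul' := fun _ _ => rfl }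

theorem shift_basis (s : ι) (h : coinduced V B) (w : List ι) :
    (shift B (B s) h).1 w = h.1 (w ++ [s]) := by
  simp [shift]

theorem shift_apply (x : g) (h : coinduced V B) (w : List ι) :
    (shift B x h).1 w = insertVec B h.1 w [] x := by
  let f : Module.End k (coinduced V B) →ₗ[k] V :=
    (LinearMap.proj w ∘ₗ (coinduced V B).subtype) ∘ₗ LinearMap.applyₗ h
  have : f ∘ₗ shift B = insertVec B h.1 w [] := B.ext fun s => by
    simpa [f] using shift_basis B s h w
  exact LinearMap.congr_fun this x

/-- On basis vectors this is the commutation relation for the last two letters of a word. Appending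
on the right makes the action a left action. -/
theorem shift_lie (x y : g) :
    shift (V := V) B ⁅x, y⁆ + shift B y * shift B x = shift B x * shift B y := by
  have hx : x ∈ Submodule.span k (Set.range B) := B.mem_span x
  have hy : y ∈ Submodule.span k (Set.range B) := B.mem_span y
  induction hx using Submodule.span_induction with
  | zero => simp
  | add x x' _ _ h h' => simp only [add_lie, map_add, ← h, ← h', add_mul, mul_add]; abel
  | smul c x _ h =>
    simp only [smul_lie, map_smul, ← h, smul_mul_assoc, mul_smul_comm, smul_add]
  | mem x hx =>
  induction hy using Submodule.span_induction with
  | zero => simp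
  | add y y' _ _ h h' => simp only [lie_add, map_add, ← h, ← h', add_mul, mul_add]; abel
  | smul c y _ h =>
    simp only [lie_smul, map_smul, ← h, smul_mul_assoc, mul_smul_comm, smul_add]
  | mem y hy =>
  obtain ⟨i, rfl⟩ := hx
  obtain ⟨j, rfl⟩ := hy
  refine LinearMap.ext fun h => Subtype.ext (funext fun w => ?_)
  have := h.2 w i j []
  simp only [Commutes] at this
  change (shift B ⁅B i, B j⁆ h).1 w + (shift B (B j) (shift B (B i) h)).1 w =
    (shift B (B i) (shift B (B j) h)).1 w
  rw [shift_apply, shift_basis, shift_basis, shift_basis, shift_basis]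
  simp [this, add_comm]

attribute [local instance] LieRing.ofAssociativeRing

variable (V) in
/-- The representation of the universal enveloping algebra on functions on words. -/
noncomputable def coinducedRep :
    UniversalEnvelopingAlgebra k g →ₐ[k] Module.End k (coinduced V B) :=
  UniversalEnvelopingAlgebra.lift k (A := Module.End k (coinduced V B))
    { shift B with map_lie' := fun {x y} => eq_sub_of_add_eq (shift_lie B x y) }

theorem coinducedRep_ι (x : g) :
    coinducedRep V B (UniversalEnvelopingAlgebra.ι k x) = shift B x :=
  UniversalEnvelopingAlgebra.lift_ι_apply k (A := Module.End k (coinduced V B)) _ x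

end Coinduced

/-! ### Words as products in the enveloping algebra -/

section WordProd

attribute [local instance] LieRing.ofAssociativeRing

/-- The product of a word in the universal enveloping algebra. -/
noncomputable def wordProd (w : List ι) : UniversalEnvelopingAlgebra k g :=
  (w.map fun i => UniversalEnvelopingAlgebra.ι k (B i)).prod

theorem wordProd_cons (i : ι) (w : List ι) :
    wordProd B (i :: w) = UniversalEnvelopingAlgebra.ι k (B i) * wordProd B w := by
  simp [wordProd]

theorem wordProd_append (u w : List ι) :
    wordProd B (u ++ w) = wordProd B u * wordProd B w := by
  simp [wordProd]

/-- At the empty word `u` this recovers the value of `h` at `w`, which is how coordinates are read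
off later. -/
theorem coinducedRep_wordProd (w u : List ι) (h : coinduced V B) :
    (coinducedRep V B (wordProd B w) h).1 u = h.1 (u ++ w) := by
  induction w generalizing u with
  | nil => simp [wordProd]
  | cons i w ih =>
    rw [wordProd_cons, map_mul, coinducedRep_ι]
    change (shift B (B i) _).1 u = _
    rw [shift_basis, ih]
    simp

variable [Module (UniversalEnvelopingAlgebra k g) V] [IsScalarTower k (UniversalEnvelopingAlgebra k g) V]

theorem insertVec_wordProd_smul (v : V) (a b : List ι) (x : g) :
    insertVec B (fun w => wordProd B w • v) a b x =
      wordProd B a • UniversalEnvelopingAlgebra.ι k x • wordProd B b • v := by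
  let f : UniversalEnvelopingAlgebra k g →ₗ[k] V :=
    { toFun := fun u => wordProd B a • u • wordProd B b • v
      map_add' := fun u u' => by rw [add_smul, smul_add]
      map_smul' := fun c u => by
        simp only [RingHom.id_apply, ← mul_smul, ← smul_assoc, mul_smul_comm, smul_mul_assoc] }
  have : insertVec B (fun w => wordProd B w • v) a b =
      f ∘ₗ (UniversalEnvelopingAlgebra.ι k : g →ₗ⁅k⁆ UniversalEnvelopingAlgebra k g).toLinearMap :=
    B.ext fun s => by
      simp only [insertVec_basis, wordProd_append, wordProd_cons, mul_smul]
      rfl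
  rw [this]
  rfl

theorem commutes_wordProd_smul (v : V) (a : List ι) (i j : ι) (b : List ι) :
    Commutes B (fun w => wordProd B w • v) a i j b := by
  simp only [Commutes, insertVec_wordProd_smul, LieHom.map_lie, LieRing.of_associative_ring_bracket,
    wordProd_append, wordProd_cons, ← mul_smul, ← add_smul]
  congr 1
  noncomm_ring

end WordProd

end Straightening

namespace W22

/-! ### The universal property of the quotient module -/

section UniversalProperty

attribute [local instance] LieRing.ofAssociativeRing

variable (φ : LieAlgebra.LieCharacter ℂ plus) (ξ : ℂ)

theorem inclU_ι (x : plus) : inclU (UniversalEnvelopingAlgebra.ι ℂ x) = toU (x : W22) :=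
  UniversalEnvelopingAlgebra.lift_ι_apply ℂ _ x

theorem isWhittakerVector_w : IsWhittakerVector φ (w φ) := by
  intro x
  have h : (1 * inclU (UniversalEnvelopingAlgebra.ι ℂ x)) ⊗ₜ[ℂ] oneDimOne φ -
      1 ⊗ₜ[ℂ] ((UniversalEnvelopingAlgebra.ι ℂ x : UPlus) • oneDimOne φ) ∈ balancing φ :=
    Submodule.subset_span ⟨_, _, _, rfl⟩
  rw [one_mul, inclU_ι, ι_smul_oneDim, TensorProduct.tmul_smul] at h
  have h' := (Submodule.Quotient.eq _).mpr h
  rw [w, ← Submodule.Quotient.mk_smul, ← Submodule.Quotient.mk_smul, ← h',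
    TensorProduct.smul_tmul', smul_eq_mul, mul_one]

theorem isWhittakerVector_wBar : IsWhittakerVector φ (wBar φ ξ) := by
  intro x
  rw [wBar, ← Submodule.Quotient.mk_smul, isWhittakerVector_w φ x, Submodule.Quotient.mk_smul]

theorem z_smul_wBar : toU z • wBar φ ξ = ξ • wBar φ ξ := by
  have h : (toU z - algebraMap ℂ U ξ) • w φ ∈ zSub φ ξ := ⟨w φ, rfl⟩
  rw [sub_smul, algebraMap_smul] at h
  have h' := (Submodule.Quotient.eq _).mpr h
  rw [wBar, ← Submodule.Quotient.mk_smul, ← Submodule.Quotient.mk_smul, h']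

variable {φ ξ} {Y : Type*} [AddCommGroup Y] [Module ℂ Y] [Module U Y] [IsScalarTower ℂ U Y]

/-- Both sides are multiplicative in `a`, so the Whittaker condition on generators suffices. This is
what kills the balancing relations. -/
theorem IsWhittakerVector.inclU_smul {v : Y} (hv : IsWhittakerVector φ v) (a : UPlus) :
    inclU a • v = (UniversalEnvelopingAlgebra.lift ℂ φ a : ℂ) • v := by
  obtain ⟨t, rfl⟩ : ∃ t, UniversalEnvelopingAlgebra.mkAlgHom ℂ plus t = a :=
    RingCon.mkₐ_surjective _ a
  induction t using TensorAlgebra.induction with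
  | algebraMap c =>
    rw [AlgHom.commutes, AlgHom.commutes, AlgHom.commutes, algebraMap_smul]
    rfl
  | ι x =>
    rw [UniversalEnvelopingAlgebra.lift_ι_apply', ← hv x, ← inclU_ι]
    rfl
  | mul a b ha hb =>
    rw [map_mul, map_mul, map_mul, mul_smul, hb, smul_comm, ha, smul_smul, mul_comm]
  | add a b ha hb => rw [map_add, map_add, map_add, add_smul, ha, hb, add_smul]

/-- The universal property of `L_{φ,ξ}`. -/
theorem exists_hom_of_isWhittakerVector {v : Y} (hv : IsWhittakerVector φ v)
    (hz : toU z • v = ξ • v) : ∃ f : LQuot φ ξ →ₗ[U] Y, f (wBar φ ξ) = v := by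
  let f₀ : U ⊗[ℂ] OneDim φ →ₗ[U] Y := TensorProduct.AlgebraTensorModule.lift
    { toFun := fun u =>
        { toFun := fun c : OneDim φ => (show ℂ from c) • u • v
          map_add' := fun c d => add_smul (R := ℂ) _ _ _
          map_smul' := fun c d => mul_smul (α := ℂ) _ _ _ }
      map_add' := fun u u' => by
        refine LinearMap.ext fun c => ?_
        change (show ℂ from c) • (u + u') • v = (show ℂ from c) • u • v + (show ℂ from c) • u' • v
        rw [add_smul, smul_add]
      map_smul' := fun u u' => by
        refine LinearMap.ext fun c => ?_
        change (show ℂ from c) • (u • u') • v = u • (show ℂ from c) • u' • v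
        rw [smul_comm u, smul_assoc] }
  have hf₀ : ∀ (u : U) (c : OneDim φ), f₀ (u ⊗ₜ c) = (show ℂ from c) • u • v := fun u c => rfl
  have h₁ : balancing φ ≤ LinearMap.ker f₀ := by
    refine Submodule.span_le.mpr ?_
    rintro _ ⟨u, a, c, rfl⟩
    change f₀ _ = 0
    rw [map_sub, hf₀, hf₀, mul_smul, hv.inclU_smul, sub_eq_zero]
    change (show ℂ from c) • u • (UniversalEnvelopingAlgebra.lift ℂ φ a : ℂ) • v =
      ((UniversalEnvelopingAlgebra.lift ℂ φ a : ℂ) * (show ℂ from c)) • u • v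
    rw [smul_comm u, smul_smul, mul_comm]
  let f₁ : M φ →ₗ[U] Y := (balancing φ).liftQ f₀ h₁
  have hf₁ : ∀ t, f₁ (Submodule.Quotient.mk t) = f₀ t := fun t => rfl
  -- The image is generated by `v`, and the central element `z - ξ` kills `v`.
  have hz' : ∀ y ∈ LinearMap.range f₁, (toU z - algebraMap ℂ U ξ) • y = 0 := by
    rintro _ ⟨m, rfl⟩
    obtain ⟨t, rfl⟩ := Submodule.Quotient.mk_surjective _ m
    rw [hf₁]
    induction t with
    | zero => simp
    | add t t' h h' => rw [map_add, smul_add, h, h', add_zero]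
    | tmul u c =>
      have hc : Commute (toU z - algebraMap ℂ U ξ) u :=
        (commute_toU_z u).sub_left (Algebra.commutes ξ u)
      rw [hf₀, smul_comm, smul_smul _ u, hc.eq, mul_smul, sub_smul, hz, algebraMap_smul, sub_self,
        smul_zero, smul_zero]
  have h₂ : zSub φ ξ ≤ LinearMap.ker f₁ := by
    rintro _ ⟨m, rfl⟩
    change f₁ _ = 0
    rw [map_smul]
    exact hz' _ ⟨m, rfl⟩
  refine ⟨(zSub φ ξ).liftQ f₁ h₂, ?_⟩
  change f₀ (1 ⊗ₜ oneDimOne φ) = v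
  rw [hf₀, one_smul]
  exact one_smul ℂ v

theorem exists_eq_smul_wBar (y : LQuot φ ξ) : ∃ u : U, y = u • wBar φ ξ := by
  obtain ⟨m, rfl⟩ := Submodule.Quotient.mk_surjective _ y
  obtain ⟨t, rfl⟩ := Submodule.Quotient.mk_surjective _ m
  induction t with
  | zero => exact ⟨0, by simp⟩
  | add t t' h h' =>
    obtain ⟨u, hu⟩ := h
    obtain ⟨u', hu'⟩ := h'
    exact ⟨u + u', by rw [Submodule.Quotient.mk_add, Submodule.Quotient.mk_add, hu, hu', add_smul]⟩
  | tmul u c =>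
    refine ⟨(show ℂ from c) • u, ?_⟩
    rw [wBar, w, ← Submodule.Quotient.mk_smul, ← Submodule.Quotient.mk_smul,
      TensorProduct.smul_tmul', smul_eq_mul, mul_one, TensorProduct.smul_tmul]
    congr 3
    exact (mul_one (M := ℂ) c).symm

end UniversalProperty

/-! ### Ordering the letters; sorted words and pairs of partitions -/

section Order

/-- The letters `L n` come first, then the `W n`, for `n ≤ 0`; the others follow. -/
def Gen.key : Gen → ℕ ×ₗ ℤ
  | L n => toLex (if n ≤ 0 then 0 else 2, n)
  | W n => toLex (if n ≤ 0 then 1 else 3, n)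
  | z => toLex (4, 0)

theorem Gen.key_injective : Function.Injective Gen.key := by
  intro a b h
  cases a <;> cases b <;>
    simp only [Gen.key, EmbeddingLike.apply_eq_iff_eq, Prod.mk.injEq] at h <;>
    first
    | rfl
    | (obtain ⟨h₁, rfl⟩ := h; first | rfl | (split_ifs at h₁ <;> omega))

noncomputable instance : LinearOrder Gen := LinearOrder.lift' Gen.key Gen.key_injective

theorem Gen.le_def (a b : Gen) : a ≤ b ↔ a.key ≤ b.key := Iff.rfl

/-- The letters that act on a Whittaker vector as scalars. -/
def Gen.IsPos : Gen → Prop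
  | L n => 0 < n
  | W n => 0 < n
  | z => True

theorem Gen.isPos_iff (a : Gen) : a.IsPos ↔ 2 ≤ (ofLex a.key).1 := by
  cases a <;> simp only [Gen.IsPos, Gen.key, ofLex_toLex] <;> (try split_ifs) <;> simp <;> omega

/-- The scalar letters form an upper set, so a sorted word not ending in one contains none. -/
theorem Gen.IsPos.mono (a b : Gen) (h : a ≤ b) (ha : a.IsPos) : b.IsPos := by
  rw [Gen.isPos_iff] at *
  rw [Gen.le_def, Prod.Lex.le_iff] at h
  rcases h with h | h
  · exact ha.trans h.le
  · exact ha.trans h.1.le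

theorem Gen.L_le_L {n m : ℤ} (hn : n ≤ 0) (hm : m ≤ 0) : L n ≤ L m ↔ n ≤ m := by
  simp [Gen.le_def, Gen.key, Prod.Lex.le_iff, hn, hm]

theorem Gen.W_le_W {n m : ℤ} (hn : n ≤ 0) (hm : m ≤ 0) : W n ≤ W m ↔ n ≤ m := by
  simp [Gen.le_def, Gen.key, Prod.Lex.le_iff, hn, hm]

theorem Gen.L_le_W {n m : ℤ} (hn : n ≤ 0) (hm : m ≤ 0) : L n ≤ W m := by
  simp [Gen.le_def, Gen.key, Prod.Lex.le_iff, hn, hm]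

theorem Gen.not_W_le_L {n m : ℤ} (hn : n ≤ 0) (hm : m ≤ 0) : ¬ W n ≤ L m := by
  simp [Gen.le_def, Gen.key, Prod.Lex.le_iff, hn, hm]

end Order

/-- The word of the monomial `L_λ W_μ`. -/
def monomialWord (p : NonposPartition × NonposPartition) : List Gen :=
  p.1.parts.map Gen.L ++ p.2.parts.map Gen.W

theorem monomialWord_injective : Function.Injective monomialWord := by
  rintro ⟨l, m⟩ ⟨l', m'⟩ h
  let f : Gen → Option ℤ := fun a => match a with | Gen.L n => some n | _ => none
  let f' : Gen → Option ℤ := fun a => match a with | Gen.W n => some n | _ => none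
  have h₁ := congrArg (List.filterMap f) h
  have h₂ := congrArg (List.filterMap f') h
  simp only [monomialWord, List.filterMap_append, List.filterMap_map] at h₁ h₂
  have e₁ : f ∘ Gen.L = some := rfl
  have e₂ : f' ∘ Gen.W = some := rfl
  have e₃ : f ∘ Gen.W = fun _ => none := rfl
  have e₄ : f' ∘ Gen.L = fun _ => none := rfl
  simp only [e₁, e₂, e₃, e₄, List.filterMap_some, List.filterMap_none, List.append_nil,
    List.nil_append] at h₁ h₂
  exact Prod.ext (NonposPartition.ext h₁) (NonposPartition.ext h₂)

theorem monomialWord_sorted (p : NonposPartition × NonposPartition) :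
    (monomialWord p).Pairwise (· ≤ ·) := by
  refine List.pairwise_append.mpr ⟨?_, ?_, ?_⟩
  · exact List.pairwise_map.mpr (p.1.sorted.imp_of_mem fun ha hb h =>
      (Gen.L_le_L (p.1.nonpos _ ha) (p.1.nonpos _ hb)).mpr h)
  · exact List.pairwise_map.mpr (p.2.sorted.imp_of_mem fun ha hb h =>
      (Gen.W_le_W (p.2.nonpos _ ha) (p.2.nonpos _ hb)).mpr h)
  · simp only [List.mem_map]
    rintro _ ⟨n, hn, rfl⟩ _ ⟨m, hm, rfl⟩
    exact Gen.L_le_W (p.1.nonpos _ hn) (p.2.nonpos _ hm)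

theorem not_isPos_of_mem_monomialWord (p : NonposPartition × NonposPartition) :
    ∀ a ∈ monomialWord p, ¬ a.IsPos := by
  simp only [monomialWord, List.mem_append, List.mem_map]
  rintro a (⟨n, hn, rfl⟩ | ⟨n, hn, rfl⟩)
  · exact (p.1.nonpos _ hn).not_gt
  · exact (p.2.nonpos _ hn).not_gt

theorem exists_monomialWord {u : List Gen} (hs : u.Pairwise (· ≤ ·)) (hp : ∀ a ∈ u, ¬ a.IsPos) :
    ∃ p, u = monomialWord p := by
  induction u with
  | nil => exact ⟨(⟨[], by simp, by simp⟩, ⟨[], by simp, by simp⟩), rfl⟩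
  | cons a u ih =>
    obtain ⟨⟨l, m⟩, rfl⟩ := ih (List.pairwise_cons.mp hs).2 fun b hb => hp b (by simp [hb])
    have ha := hp a (by simp)
    have hle := (List.pairwise_cons.mp hs).1
    cases a with
    | z => exact absurd trivial ha
    | L n =>
      have hn : n ≤ 0 := not_lt.mp ha
      refine ⟨(⟨n :: l.parts, List.pairwise_cons.mpr ⟨fun i hi => ?_, l.sorted⟩, ?_⟩, m), rfl⟩
      · exact (Gen.L_le_L hn (l.nonpos i hi)).mp (hle _ (by simp [monomialWord, hi]))
      · simpa [hn] using l.nonpos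
    | W n =>
      have hn : n ≤ 0 := not_lt.mp ha
      have hl : l.parts = [] := by
        by_contra h
        obtain ⟨i, hi⟩ := List.exists_mem_of_ne_nil _ h
        exact Gen.not_W_le_L hn (l.nonpos i hi) (hle _ (by simp [monomialWord, hi]))
      refine ⟨(l, ⟨n :: m.parts, List.pairwise_cons.mpr ⟨fun i hi => ?_, m.sorted⟩, ?_⟩), ?_⟩
      · exact (Gen.W_le_W hn (m.nonpos i hi)).mp (hle _ (by simp [monomialWord, hi]))
      · simpa [hn] using m.nonpos
      · simp [monomialWord, hl]

end W22

namespace W22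

open Straightening

attribute [local instance] LieRing.ofAssociativeRing

theorem toU_zero : toU 0 = 0 := map_zero (UniversalEnvelopingAlgebra.ι ℂ : W22 →ₗ⁅ℂ⁆ U)

theorem toU_add (x y : W22) : toU (x + y) = toU x + toU y :=
  map_add (UniversalEnvelopingAlgebra.ι ℂ : W22 →ₗ⁅ℂ⁆ U) x y

theorem toU_smul (c : ℂ) (x : W22) : toU (c • x) = c • toU x :=
  map_smul (UniversalEnvelopingAlgebra.ι ℂ : W22 →ₗ⁅ℂ⁆ U) c x

theorem toU_lie (x y : W22) : toU ⁅x, y⁆ = toU x * toU y - toU y * toU x :=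
  LieHom.map_lie (UniversalEnvelopingAlgebra.ι ℂ : W22 →ₗ⁅ℂ⁆ U) x y

/-! ### The linear form given by the character and the central value -/

section Scalar

variable (φ : LieAlgebra.LieCharacter ℂ plus) (ξ : ℂ)

open Classical in
/-- The extension of `φ` and `z ↦ ξ` to a linear form on `W(2,2)`. -/
noncomputable def scalar : W22 →ₗ[ℂ] ℂ :=
  stdBasis.constr ℂ fun a => match a with
    | Gen.L n => if h : 0 < n then φ ⟨L n, L_mem_plus h⟩ else 0
    | Gen.W n => if h : 0 < n then φ ⟨W n, W_mem_plus h⟩ else 0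
    | Gen.z => ξ

theorem scalar_L {n : ℤ} (h : 0 < n) : scalar φ ξ (L n) = φ ⟨L n, L_mem_plus h⟩ := by
  have e : scalar φ ξ (stdBasis (Gen.L n)) = _ := Module.Basis.constr_basis _ _ _ _
  simpa [h, stdBasis_L] using e

theorem scalar_W {n : ℤ} (h : 0 < n) : scalar φ ξ (W n) = φ ⟨W n, W_mem_plus h⟩ := by
  have e : scalar φ ξ (stdBasis (Gen.W n)) = _ := Module.Basis.constr_basis _ _ _ _
  simpa [h, stdBasis_W] using e

theorem scalar_z : scalar φ ξ z = ξ := by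
  rw [← stdBasis_z, scalar, Module.Basis.constr_basis]

theorem scalar_plus (x : plus) : scalar φ ξ x = φ x := by
  have h : ∀ x ∈ plus, ∃ h : x ∈ plus, scalar φ ξ x = φ ⟨x, h⟩ := by
    intro x hx
    refine Submodule.span_induction (p := fun x _ => ∃ h : x ∈ plus, scalar φ ξ x = φ ⟨x, h⟩)
      ?_ ?_ ?_ ?_ hx
    · rintro _ ⟨n, hn, rfl | rfl⟩
      · exact ⟨_, scalar_L φ ξ hn⟩
      · exact ⟨_, scalar_W φ ξ hn⟩
    · refine ⟨zero_mem _, ?_⟩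
      rw [map_zero]
      exact (map_zero φ).symm
    · rintro x y _ _ ⟨hx, ex⟩ ⟨hy, ey⟩
      refine ⟨add_mem hx hy, ?_⟩
      rw [map_add, ex, ey]
      exact (map_add φ ⟨x, hx⟩ ⟨y, hy⟩).symm
    · rintro c x _ ⟨hx, ex⟩
      refine ⟨plus.smul_mem c hx, ?_⟩
      rw [map_smul, ex]
      exact (map_smul φ c ⟨x, hx⟩).symm
  exact (h x x.2).choose_spec

theorem stdBasis_mem_plus {a : Gen} (ha : a.IsPos) : a = Gen.z ∨ stdBasis a ∈ plus := by
  cases a with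
  | L n => exact Or.inr (L_mem_plus ha)
  | W n => exact Or.inr (W_mem_plus ha)
  | z => exact Or.inl rfl

theorem plus_le_span : plus.toSubmodule ≤ Submodule.span ℂ (stdBasis '' {a | a.IsPos}) := by
  refine Submodule.span_mono ?_
  rintro _ ⟨n, hn, rfl | rfl⟩
  · exact ⟨Gen.L n, hn, rfl⟩
  · exact ⟨Gen.W n, hn, rfl⟩

theorem lie_pos {a b : Gen} (ha : a.IsPos) (hb : b.IsPos) :
    ⁅stdBasis a, stdBasis b⁆ = 0 ∨ ∃ h : stdBasis a ∈ plus, ∃ h' : stdBasis b ∈ plus,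
      ⁅stdBasis a, stdBasis b⁆ = (⁅(⟨_, h⟩ : plus), (⟨_, h'⟩ : plus)⁆ : plus) := by
  rcases stdBasis_mem_plus ha with rfl | ha
  · exact Or.inl (bracketMap_z_left _)
  · rcases stdBasis_mem_plus hb with rfl | hb
    · exact Or.inl (bracketMap_z_right _)
    · exact Or.inr ⟨ha, hb, rfl⟩

theorem lie_pos_mem_span (a b : Gen) (ha : a.IsPos) (hb : b.IsPos) :
    ⁅stdBasis a, stdBasis b⁆ ∈ Submodule.span ℂ (stdBasis '' {a | a.IsPos}) := by
  rcases lie_pos ha hb with h | ⟨h, h', e⟩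
  · rw [h]
    exact zero_mem _
  · rw [e]
    exact plus_le_span (Subtype.property _)

/-- Characters vanish on brackets, and brackets with `z` are zero. This is the consistency condition
for absorbing trailing letters. -/
theorem scalar_lie (a b : Gen) (ha : a.IsPos) (hb : b.IsPos) :
    scalar φ ξ ⁅stdBasis a, stdBasis b⁆ = 0 := by
  rcases lie_pos ha hb with h | ⟨h, h', e⟩
  · rw [h, map_zero]
  · rw [e, scalar_plus, LieAlgebra.lieCharacter_apply_lie]

theorem stdBasis_smul_wBar {a : Gen} (ha : a.IsPos) :
    toU (stdBasis a) • wBar φ ξ = scalar φ ξ (stdBasis a) • wBar φ ξ := by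
  rcases stdBasis_mem_plus ha with rfl | h
  · rw [stdBasis_z, z_smul_wBar, scalar_z]
  · have := isWhittakerVector_wBar φ ξ ⟨_, h⟩
    rw [← scalar_plus φ ξ] at this
    exact this

end Scalar

/-! ### The monomial basis -/

/-- The coinduced `W(2,2)`-module of functions on words. -/
def Coind : Type := coinduced (List Gen →₀ ℂ) stdBasis

noncomputable instance : AddCommGroup Coind :=
  inferInstanceAs (AddCommGroup (coinduced (List Gen →₀ ℂ) stdBasis))

noncomputable instance : Module ℂ Coind :=
  inferInstanceAs (Module ℂ (coinduced (List Gen →₀ ℂ) stdBasis))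

noncomputable instance : Module U Coind :=
  Module.compHom (coinduced (List Gen →₀ ℂ) stdBasis)
    (coinducedRep (List Gen →₀ ℂ) stdBasis).toRingHom

theorem Coind.smul_def (u : U) (h : Coind) :
    u • h = coinducedRep (List Gen →₀ ℂ) stdBasis u h := rfl

instance : IsScalarTower ℂ U Coind where
  smul_assoc c u h := by
    rw [Coind.smul_def, Coind.smul_def, map_smul]
    rfl

variable (φ : LieAlgebra.LieCharacter ℂ plus) (ξ : ℂ)

/-- The Whittaker vector of the coinduced module given by the normal form of words. -/
noncomputable def coindVec : Coind :=
  ⟨normalForm stdBasis Gen.IsPos (scalar φ ξ) fun u => Finsupp.single u 1,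
    commutes_normalForm stdBasis _ Gen.IsPos.mono lie_pos_mem_span (scalar_lie φ ξ)⟩

theorem stdBasis_smul_coindVec {a : Gen} (ha : a.IsPos) :
    toU (stdBasis a) • coindVec φ ξ = scalar φ ξ (stdBasis a) • coindVec φ ξ := by
  refine Subtype.ext (funext fun u => ?_)
  rw [Coind.smul_def, coinducedRep_ι]
  exact (shift_basis stdBasis a (coindVec φ ξ) u).trans (normalForm_concat _ _ _ _ ha u)

theorem isWhittakerVector_coindVec : IsWhittakerVector φ (coindVec φ ξ) := by
  rintro ⟨x, hx⟩
  rw [← scalar_plus φ ξ]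
  change toU x • _ = scalar φ ξ x • _
  refine Submodule.span_induction
    (p := fun x _ => toU x • coindVec φ ξ = scalar φ ξ x • coindVec φ ξ) ?_ ?_ ?_ ?_ hx
  · rintro _ ⟨n, hn, rfl | rfl⟩
    · exact stdBasis_smul_coindVec φ ξ (a := Gen.L n) hn
    · exact stdBasis_smul_coindVec φ ξ (a := Gen.W n) hn
  · rw [toU_zero, map_zero, zero_smul, zero_smul]
  · intro x y _ _ hx hy
    rw [toU_add, map_add, add_smul, add_smul, hx, hy]
  · intro c x _ hx
    rw [toU_smul, map_smul, smul_assoc, smul_assoc, hx]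

/-- The product of a word of letters, applied to the cyclic vector. -/
noncomputable def wordVec (u : List Gen) : LQuot φ ξ := wordProd stdBasis u • wBar φ ξ

theorem commutes_wordVec (a : List Gen) (i j : Gen) (b : List Gen) :
    Commutes stdBasis (wordVec φ ξ) a i j b :=
  commutes_wordProd_smul stdBasis (wBar φ ξ) a i j b

theorem wordVec_cons (a : Gen) (u : List Gen) :
    wordVec φ ξ (a :: u) = toU (stdBasis a) • wordVec φ ξ u := by
  rw [wordVec, wordProd_cons, mul_smul]
  rfl

theorem wordVec_concat (u : List Gen) (a : Gen) (ha : a.IsPos) :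
    wordVec φ ξ (u ++ [a]) = scalar φ ξ (stdBasis a) • wordVec φ ξ u := by
  have : wordProd stdBasis [a] = toU (stdBasis a) := by simp [wordProd]
  rw [wordVec, wordProd_append, mul_smul, this, stdBasis_smul_wBar φ ξ ha, smul_comm]
  rfl

/-- The homomorphism sending `wBar` to `coindVec`, followed by evaluation at the empty word, maps
each monomial to the normal form of its word. That word is already sorted, so the result is its own
basis vector. -/
theorem linearIndependent_monomials :
    LinearIndependent ℂ fun p => wordVec φ ξ (monomialWord p) := by
  obtain ⟨f, hf⟩ := exists_hom_of_isWhittakerVector (isWhittakerVector_coindVec φ ξ)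
    ((stdBasis_smul_coindVec φ ξ (a := Gen.z) trivial).trans
      (by rw [stdBasis_z, scalar_z]))
  let ev : Coind →ₗ[ℂ] (List Gen →₀ ℂ) :=
    LinearMap.proj [] ∘ₗ (coinduced (List Gen →₀ ℂ) stdBasis).subtype
  refine LinearIndependent.of_comp (ev ∘ₗ f.restrictScalars ℂ) ?_
  have : (ev ∘ₗ f.restrictScalars ℂ) ∘ (fun p => wordVec φ ξ (monomialWord p)) =
      (fun u => Finsupp.single u (1 : ℂ)) ∘ monomialWord := by
    funext p
    change ev (f (wordVec φ ξ (monomialWord p))) = _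
    rw [wordVec, map_smul, hf, Coind.smul_def]
    refine (coinducedRep_wordProd stdBasis (monomialWord p) [] (coindVec φ ξ)).trans ?_
    exact normalForm_sorted _ _ _ _ (monomialWord_sorted p) (not_isPos_of_mem_monomialWord p)
  rw [this]
  exact (Finsupp.basisSingleOne (R := ℂ) (ι := List Gen)).linearIndependent.comp _
    monomialWord_injective

/-- The number of letters `L n` counts as the weight of a word. -/
def Gen.weight : Gen → ℕ
  | L _ => 1
  | _ => 0

/-- A bracket of two letters `L` has at most one letter `L` per term, and brackets involving a `W`
have none. -/
theorem lie_mem_span_weight (a b : Gen) : ⁅stdBasis a, stdBasis b⁆ ∈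
    Submodule.span ℂ (stdBasis '' {t | t.weight ≤ a.weight + b.weight}) := by
  have hL : ∀ n, 1 ≤ a.weight + b.weight →
      L n ∈ Submodule.span ℂ (stdBasis '' {t | t.weight ≤ a.weight + b.weight}) :=
    fun n h => Submodule.subset_span ⟨Gen.L n, h, rfl⟩
  have hW : ∀ n,
      W n ∈ Submodule.span ℂ (stdBasis '' {t | t.weight ≤ a.weight + b.weight}) :=
    fun n => Submodule.subset_span ⟨Gen.W n, Nat.zero_le _, rfl⟩
  have hz : z ∈ Submodule.span ℂ (stdBasis '' {t | t.weight ≤ a.weight + b.weight}) :=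
    Submodule.subset_span ⟨Gen.z, Nat.zero_le _, rfl⟩
  rw [bracket_def, bracketMap_stdBasis]
  generalize hS : Submodule.span ℂ (stdBasis '' {t | t.weight ≤ a.weight + b.weight}) = S at *
  cases a <;> cases b <;> simp only [genBracket] <;>
    first
    | exact zero_mem _
    | exact add_mem (S.smul_mem _ (hL _ (by simp [Gen.weight]))) (S.smul_mem _ hz)
    | exact add_mem (S.smul_mem _ (hW _)) (S.smul_mem _ hz)
    | exact neg_mem (add_mem (S.smul_mem _ (hW _)) (S.smul_mem _ hz))

/-- The span of the monomials with at most `s - d` letters `L n`. -/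
noncomputable def filt (d s : ℕ) : Submodule ℂ (LQuot φ ξ) :=
  Submodule.span ℂ ((fun p => wordVec φ ξ (monomialWord p)) '' {p | p.1.parts.length + d ≤ s})

theorem weight_monomialWord (p : NonposPartition × NonposPartition) :
    ((monomialWord p).map Gen.weight).sum = p.1.parts.length := by
  have h₁ : Gen.weight ∘ Gen.L = fun _ => 1 := rfl
  have h₂ : Gen.weight ∘ Gen.W = fun _ => 0 := rfl
  simp [monomialWord, h₁, h₂]

theorem wordVec_mem_filt {d s : ℕ} {u : List Gen} (hu : (u.map Gen.weight).sum + d ≤ s) :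
    wordVec φ ξ u ∈ filt φ ξ d s := by
  have := mem_span_sorted stdBasis (P := Gen.IsPos) Gen.IsPos.mono (commutes_wordVec φ ξ)
    (wordVec_concat φ ξ) Gen.weight lie_mem_span_weight (s - d) u (by omega)
  refine Submodule.span_mono ?_ this
  rintro _ ⟨u, ⟨h₁, h₂, h₃⟩, rfl⟩
  obtain ⟨p, rfl⟩ := exists_monomialWord h₁ h₂
  rw [weight_monomialWord] at h₃
  exact ⟨p, show _ + d ≤ s by omega, rfl⟩

theorem mem_span_wordVec (y : LQuot φ ξ) : y ∈ Submodule.span ℂ (Set.range (wordVec φ ξ)) := by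
  obtain ⟨u, rfl⟩ := exists_eq_smul_wBar y
  suffices h : ∀ y ∈ Submodule.span ℂ (Set.range (wordVec φ ξ)),
      u • y ∈ Submodule.span ℂ (Set.range (wordVec φ ξ)) from
    h _ (Submodule.subset_span ⟨[], by simp [wordVec, wordProd]⟩)
  have hg : ∀ x : W22, ∀ y ∈ Submodule.span ℂ (Set.range (wordVec φ ξ)),
      toU x • y ∈ Submodule.span ℂ (Set.range (wordVec φ ξ)) := by
    intro x
    induction x using stdBasis_induction with
    | basis a =>
      intro y hy
      induction hy using Submodule.span_induction with
      | mem y hy =>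
        obtain ⟨u, rfl⟩ := hy
        exact Submodule.subset_span ⟨a :: u, wordVec_cons φ ξ a u⟩
      | zero => rw [smul_zero]; exact zero_mem _
      | add y y' _ _ h h' => rw [smul_add]; exact add_mem h h'
      | smul c y _ h => rw [smul_comm]; exact Submodule.smul_mem _ c h
    | add x x' h h' =>
      intro y hy
      rw [toU_add, add_smul]
      exact add_mem (h y hy) (h' y hy)
    | smul c x h =>
      intro y hy
      rw [toU_smul, smul_assoc]
      exact Submodule.smul_mem _ c (h y hy)
  obtain ⟨t, rfl⟩ : ∃ t, UniversalEnvelopingAlgebra.mkAlgHom ℂ W22 t = u :=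
    RingCon.mkₐ_surjective _ u
  induction t using TensorAlgebra.induction with
  | algebraMap c =>
    intro y hy
    rw [AlgHom.commutes, algebraMap_smul]
    exact Submodule.smul_mem _ c hy
  | ι x => exact hg x
  | mul a b ha hb => intro y hy; rw [map_mul, mul_smul]; exact ha _ (hb _ hy)
  | add a b ha hb => intro y hy; rw [map_add, add_smul]; exact add_mem (ha _ hy) (hb _ hy)

/-- The basis of `L_{φ,ξ}` formed by the monomials. -/
noncomputable def monomialBasis : Module.Basis (NonposPartition × NonposPartition) ℂ (LQuot φ ξ) :=
  Module.Basis.mk (linearIndependent_monomials φ ξ) fun y _ => by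
    refine (Submodule.span_le.mpr ?_) (mem_span_wordVec φ ξ y)
    rintro _ ⟨u, rfl⟩
    exact Submodule.span_mono (Set.image_subset_range _ _) (wordVec_mem_filt φ ξ (d := 0) le_rfl)

theorem monomialBasis_apply (p : NonposPartition × NonposPartition) :
    monomialBasis φ ξ p = wordVec φ ξ (monomialWord p) := by
  simp [monomialBasis]

theorem wordVec_monomialWord (l m : NonposPartition) :
    wordVec φ ξ (monomialWord (l, m)) = (LMon l * WMon m) • wBar φ ξ := by
  rw [wordVec, monomialWord, wordProd_append]
  simp only [wordProd, List.map_map]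
  rfl

end W22

namespace W22

open Straightening

attribute [local instance] LieRing.ofAssociativeRing

/-! ### The action of positive elements on monomials -/

section Vanishing

variable (φ : LieAlgebra.LieCharacter ℂ plus) (ξ : ℂ)

theorem centralCoeff_of_ne {n m : ℤ} (h : m + n ≠ 0) : centralCoeff n m = 0 := if_neg h

/-- `⁅L 1, W (n - 1)⁆ = (n - 2) • W n`, and the form vanishes on this bracket. -/
theorem scalar_W_of_three_le {n : ℤ} (hn : 3 ≤ n) : scalar φ ξ (W n) = 0 := by
  have h := scalar_lie φ ξ (Gen.L 1) (Gen.W (n - 1)) one_pos (show 0 < n - 1 by omega)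
  rw [stdBasis_L, stdBasis_W, bracket_def, bracketMap_LW, centralCoeff_of_ne (by omega), zero_smul,
    add_zero, map_smul, sub_add_cancel, smul_eq_mul] at h
  refine (mul_eq_zero.mp h).resolve_left ?_
  norm_cast
  omega

end Vanishing

section Relations

variable {V : Type*} [AddCommGroup V] [Module U V]

theorem W_smul_W_smul (i j : ℤ) (v : V) :
    toU (W j) • toU (W i) • v = toU (W i) • toU (W j) • v := by
  have h := toU_lie (W j) (W i)
  rw [bracket_def, bracketMap_WW, toU_zero] at h
  rw [smul_smul, smul_smul, sub_eq_zero.mp h.symm]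

variable [Module ℂ V] [IsScalarTower ℂ U V]

theorem L_smul_W_smul (i j : ℤ) (v : V) :
    toU (L i) • toU (W j) • v = toU (W j) • toU (L i) • v +
      (((j : ℂ) - i) • toU (W (j + i)) • v + centralCoeff i j • toU z • v) := by
  have h := toU_lie (L i) (W j)
  rw [bracket_def, bracketMap_LW, toU_add, toU_smul, toU_smul] at h
  rw [smul_smul, smul_smul, ← smul_assoc, ← smul_assoc, ← add_smul, ← add_smul, h]
  congr 1
  abel

end Relations

variable (φ : LieAlgebra.LieCharacter ℂ plus) (ξ : ℂ)

/-- The monomial with the given indices applied to the cyclic vector. -/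
noncomputable def vec (l f : List ℤ) : LQuot φ ξ := wordVec φ ξ (l.map Gen.L ++ f.map Gen.W)

theorem vec_cons (i : ℤ) (l f : List ℤ) : vec φ ξ (i :: l) f = toU (L i) • vec φ ξ l f :=
  wordVec_cons φ ξ (Gen.L i) _

theorem vec_nil_cons (i : ℤ) (f : List ℤ) : vec φ ξ [] (i :: f) = toU (W i) • vec φ ξ [] f :=
  wordVec_cons φ ξ (Gen.W i) _

theorem vec_nil_nil : vec φ ξ [] [] = wBar φ ξ := by
  simp [vec, wordVec, wordProd]

theorem weight_vec (l f : List ℤ) :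
    ((l.map Gen.L ++ f.map Gen.W).map Gen.weight).sum = l.length := by
  have h₁ : Gen.weight ∘ Gen.L = fun _ => 1 := rfl
  have h₂ : Gen.weight ∘ Gen.W = fun _ => 0 := rfl
  simp [h₁, h₂]

theorem toU_smul_vec_mem {a : Gen} (ha : a.weight = 0) (l f : List ℤ) (d : ℕ) :
    toU (stdBasis a) • vec φ ξ l f ∈ filt φ ξ d (l.length + d) := by
  rw [vec, ← wordVec_cons]
  refine wordVec_mem_filt φ ξ ?_
  rw [List.map_cons, List.sum_cons, ha, weight_vec, zero_add]

theorem L_smul_mem_filt (i : ℤ) {d s : ℕ} {y : LQuot φ ξ} (hy : y ∈ filt φ ξ d s) :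
    toU (L i) • y ∈ filt φ ξ d (s + 1) := by
  induction hy using Submodule.span_induction with
  | mem y hy =>
    obtain ⟨p, hp, rfl⟩ := hy
    have := wordVec_cons φ ξ (Gen.L i) (monomialWord p)
    rw [stdBasis_L] at this
    change toU (L i) • wordVec φ ξ (monomialWord p) ∈ _
    rw [← this]
    refine wordVec_mem_filt φ ξ ?_
    rw [List.map_cons, List.sum_cons, weight_monomialWord, Gen.weight]
    have : p.1.parts.length + d ≤ s := hp
    omega
  | zero => rw [smul_zero]; exact zero_mem _
  | add y y' _ _ h h' => rw [smul_add]; exact add_mem h h'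
  | smul c y _ h => rw [smul_comm]; exact Submodule.smul_mem _ c h

theorem W_smul_vec_nil {j : ℤ} (hj : 0 < j) (f : List ℤ) :
    toU (W j) • vec φ ξ [] f = scalar φ ξ (W j) • vec φ ξ [] f := by
  induction f with
  | nil =>
    rw [vec_nil_nil]
    exact stdBasis_smul_wBar φ ξ (a := Gen.W j) hj
  | cons i f ih => rw [vec_nil_cons, W_smul_W_smul, ih, smul_comm]

/-- On monomials, `W j - φ (W j)` lowers the number of letters `L n`. -/
theorem W_smul_vec_sub_mem {j : ℤ} (hj : 0 < j) (l f : List ℤ) :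
    toU (W j) • vec φ ξ l f - scalar φ ξ (W j) • vec φ ξ l f ∈ filt φ ξ 1 l.length := by
  induction l with
  | nil => rw [W_smul_vec_nil φ ξ hj, sub_self]; exact zero_mem _
  | cons i l ih =>
    have h := L_smul_W_smul i j (vec φ ξ l f)
    -- Moving `W j` past `L i` costs terms in `W (j + i)` and `z`, in which the letter `L i` has
    -- been lost.
    have e : toU (W j) • vec φ ξ (i :: l) f - scalar φ ξ (W j) • vec φ ξ (i :: l) f =
        toU (L i) • (toU (W j) • vec φ ξ l f - scalar φ ξ (W j) • vec φ ξ l f) -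
          (((j : ℂ) - i) • toU (W (j + i)) • vec φ ξ l f +
            centralCoeff i j • toU z • vec φ ξ l f) := by
      rw [vec_cons, smul_sub, h, smul_comm (toU (L i)) (scalar φ ξ (W j))]
      abel
    rw [e]
    exact sub_mem (L_smul_mem_filt φ ξ i ih) (add_mem
      (Submodule.smul_mem _ _ (toU_smul_vec_mem φ ξ (a := Gen.W (j + i)) rfl l f 1))
      (Submodule.smul_mem _ _ (toU_smul_vec_mem φ ξ (a := Gen.z) rfl l f 1)))

theorem eq_cons_tail_of_mem {m : ℤ} {l : List ℤ} (hs : l.Pairwise (· ≤ ·)) (hm : ∀ i ∈ l, m ≤ i)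
    (h : m ∈ l) : l = m :: l.tail := by
  cases l with
  | nil => simp at h
  | cons i l =>
    have h₁ := hm i (by simp)
    rcases List.mem_cons.mp h with rfl | h
    · rfl
    · have h₂ := (List.pairwise_cons.mp hs).1 m h
      rw [le_antisymm h₁ h₂]
      rfl

/-- The leading term of `W (2 - m) - φ (W (2 - m))` on monomials. -/
theorem W_smul_vec_leading {m : ℤ} (hm : m ≤ 0) {l : List ℤ} (hs : l.Pairwise (· ≤ ·))
    (hl : ∀ i ∈ l, m ≤ i) (f : List ℤ) :
    toU (W (2 - m)) • vec φ ξ l f - scalar φ ξ (W (2 - m)) • vec φ ξ l f -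
      ((2 * (m : ℂ) - 2) * scalar φ ξ (W 2) * l.count m) • vec φ ξ l.tail f ∈
        filt φ ξ 2 l.length := by
  induction l with
  | nil =>
    rw [W_smul_vec_nil φ ξ (by omega), sub_self]
    simp
  | cons i l ih =>
    have hs' := (List.pairwise_cons.mp hs).2
    have hl' : ∀ i ∈ l, m ≤ i := fun j hj => hl j (by simp [hj])
    have hi := hl i (by simp)
    have ih := L_smul_mem_filt φ ξ i (ih hs' hl')
    -- The new index `2 - m + i` is at least `2`, so this factor is a scalar up to one further loss
    -- of a letter `L`, that is, two fewer than in `i :: l`.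
    have hB : toU (W (2 - m + i)) • vec φ ξ l f - scalar φ ξ (W (2 - m + i)) • vec φ ξ l f ∈
        filt φ ξ 2 (l.length + 1) := by
      refine Submodule.span_mono (Set.image_mono fun p hp => ?_)
        (W_smul_vec_sub_mem φ ξ (j := 2 - m + i) (by omega) l f)
      exact Nat.succ_le_succ hp
    have h := L_smul_W_smul i (2 - m) (vec φ ξ l f)
    rw [centralCoeff_of_ne (by omega), zero_smul, add_zero] at h
    rw [List.length_cons, List.tail_cons, vec_cons]
    have hW : toU (W (2 - m)) • toU (L i) • vec φ ξ l f =
        toU (L i) • toU (W (2 - m)) • vec φ ξ l f -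
          (((2 - m : ℤ) : ℂ) - i) • toU (W (2 - m + i)) • vec φ ξ l f := by
      rw [h]; abel
    rw [hW]
    have hmem := sub_mem ih (Submodule.smul_mem _ (((2 - m : ℤ) : ℂ) - i) hB)
    convert hmem using 1
    rw [smul_sub (toU (L i)), smul_sub (toU (L i)), smul_comm (toU (L i)) (scalar φ ξ _),
      smul_comm (toU (L i)) (_ * _)]
    -- For `i = m` the new factor is `W 2`, with coefficient `-((2 - m) - m) = 2m - 2`, and the
    -- count rises by one. For `i > m` the index is at least `3`, so its scalar vanishes, and
    -- sortedness excludes `m` from `l`.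
    rcases hi.eq_or_lt with rfl | hi
    · have key : ((l.count m : ℕ) : ℂ) • toU (L m) • vec φ ξ l.tail f =
          ((l.count m : ℕ) : ℂ) • vec φ ξ l f := by
        by_cases h : m ∈ l
        · rw [← vec_cons, ← eq_cons_tail_of_mem hs' hl' h]
        · rw [List.count_eq_zero_of_not_mem h, Nat.cast_zero, zero_smul, zero_smul]
      rw [List.count_cons_self, sub_add_cancel, mul_smul _ (((l.count m : ℕ) : ℂ)), key]
      generalize toU (L m) • toU (W (2 - m)) • vec φ ξ l f = y₁
      generalize toU (L m) • vec φ ξ l f = y₂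
      generalize toU (W 2) • vec φ ξ l f = y₃
      push_cast
      module
    · have h₁ : m ∉ l := fun h => hi.not_ge ((List.pairwise_cons.mp hs).1 m h)
      rw [List.count_eq_zero_of_not_mem h₁, List.count_cons_of_ne hi.ne',
        List.count_eq_zero_of_not_mem h₁, scalar_W_of_three_le φ ξ (n := 2 - m + i) (by omega)]
      generalize toU (L i) • toU (W (2 - m)) • vec φ ξ l f = y₁
      generalize toU (L i) • vec φ ξ l f = y₂
      generalize toU (L i) • vec φ ξ l.tail f = y₄
      generalize toU (W (2 - m + i)) • vec φ ξ l f = y₃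
      push_cast
      module

/-- The action of `L (2 - m) - φ (L (2 - m))` on monomials in the `W n`. -/
theorem L_smul_vec_nil {m : ℤ} (hm : m ≤ 0) {f : List ℤ} (hs : f.Pairwise (· ≤ ·))
    (hf : ∀ i ∈ f, m ≤ i) :
    toU (L (2 - m)) • vec φ ξ [] f = scalar φ ξ (L (2 - m)) • vec φ ξ [] f +
      ((2 * (m : ℂ) - 2) * scalar φ ξ (W 2) * f.count m) • vec φ ξ [] f.tail := by
  induction f with
  | nil =>
    have h := stdBasis_smul_wBar φ ξ (a := Gen.L (2 - m)) (show 0 < 2 - m by omega)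
    rw [stdBasis_L] at h
    rw [vec_nil_nil, h]
    simp
  | cons i f ih =>
    have hs' := (List.pairwise_cons.mp hs).2
    have hf' : ∀ i ∈ f, m ≤ i := fun j hj => hf j (by simp [hj])
    have hi := hf i (by simp)
    rw [vec_nil_cons, L_smul_W_smul, ih hs' hf', centralCoeff_of_ne (by omega), zero_smul, add_zero,
      W_smul_vec_nil φ ξ (by omega), smul_add, smul_comm (toU (W i)) (scalar φ ξ _),
      smul_comm (toU (W i)) (_ * _), List.tail_cons]
    -- The same dichotomy, with coefficient `m - (2 - m)`. It is exact because the created `W`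
    -- commutes with the remaining letters.
    rcases hi.eq_or_lt with rfl | hi
    · have key : ((f.count m : ℕ) : ℂ) • toU (W m) • vec φ ξ [] f.tail =
          ((f.count m : ℕ) : ℂ) • vec φ ξ [] f := by
        by_cases h : m ∈ f
        · rw [← vec_nil_cons, ← eq_cons_tail_of_mem hs' hf' h]
        · rw [List.count_eq_zero_of_not_mem h, Nat.cast_zero, zero_smul, zero_smul]
      rw [List.count_cons_self, add_sub_cancel, mul_smul _ (((f.count m : ℕ) : ℂ)), key]
      generalize toU (W m) • vec φ ξ [] f = y
      push_cast
      module
    · have h₁ : m ∉ f := fun h => hi.not_ge ((List.pairwise_cons.mp hs).1 m h)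
      rw [List.count_eq_zero_of_not_mem h₁, List.count_cons_of_ne hi.ne',
        List.count_eq_zero_of_not_mem h₁, scalar_W_of_three_le φ ξ (n := i + (2 - m)) (by omega)]
      generalize toU (W i) • vec φ ξ [] f = y
      generalize toU (W i) • vec φ ξ [] f.tail = y₁
      push_cast
      module

/-- The partition without its first part. -/
def NonposPartition.tail (l : NonposPartition) : NonposPartition where
  parts := l.parts.tail
  sorted := l.sorted.sublist (List.tail_sublist _)
  nonpos i hi := l.nonpos i (List.mem_of_mem_tail hi)

theorem monomialBasis_eq_vec (p : NonposPartition × NonposPartition) :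
    monomialBasis φ ξ p = vec φ ξ p.1.parts p.2.parts :=
  monomialBasis_apply φ ξ p

theorem repr_eq_zero_of_mem_filt {d s : ℕ} {y : LQuot φ ξ} (hy : y ∈ filt φ ξ d s)
    {q : NonposPartition × NonposPartition} (hq : s < q.1.parts.length + d) :
    (monomialBasis φ ξ).repr y q = 0 := by
  induction hy using Submodule.span_induction with
  | mem y hy =>
    obtain ⟨p, hp, rfl⟩ := hy
    change (monomialBasis φ ξ).repr (wordVec φ ξ (monomialWord p)) q = 0
    rw [← monomialBasis_apply, Module.Basis.repr_self]
    refine Finsupp.single_eq_of_ne fun h => ?_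
    subst h
    exact absurd hq (not_lt.mpr hp)
  | zero => simp
  | add y y' _ _ h h' => rw [map_add, Finsupp.add_apply, h, h', add_zero]
  | smul c y _ h => rw [map_smul, Finsupp.smul_apply, h, smul_zero]

/-- The least part `m` stands first in both. This injectivity prevents leading terms of different
monomials from cancelling. -/
theorem NonposPartition.eq_of_tail_eq {m : ℤ} {l l' : NonposPartition} (hl : ∀ i ∈ l.parts, m ≤ i)
    (hl' : ∀ i ∈ l'.parts, m ≤ i) (h : m ∈ l.parts) (h' : m ∈ l'.parts) (e : l.tail = l'.tail) :
    l = l' := by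
  apply NonposPartition.ext
  rw [eq_cons_tail_of_mem l.sorted hl h, eq_cons_tail_of_mem l'.sorted hl' h']
  exact congrArg (m :: ·) (congrArg NonposPartition.parts e)

/-- The first part of a non-empty partition is the least one. -/
theorem NonposPartition.headD_le (l : NonposPartition) : ∀ i ∈ l.parts, l.parts.headD 0 ≤ i := by
  have hs := l.sorted
  cases h : l.parts with
  | nil => simp
  | cons j t =>
    rw [h] at hs
    intro i hi
    rcases List.mem_cons.mp hi with rfl | hi
    · exact le_rfl
    · exact (List.pairwise_cons.mp hs).1 i hi

theorem NonposPartition.headD_mem {l : NonposPartition} (h : l.parts ≠ []) :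
    l.parts.headD 0 ∈ l.parts := by
  cases e : l.parts with
  | nil => exact absurd e h
  | cons j t => simp

/-! ### Uniqueness of Whittaker vectors -/

section Uniqueness

variable {φ ξ} {v : LQuot φ ξ}

theorem leading_ne_zero {m : ℤ} (hm : m ≤ 0) (hW : scalar φ ξ (W 2) ≠ 0) {l : List ℤ}
    (hl : m ∈ l) : (2 * (m : ℂ) - 2) * scalar φ ξ (W 2) * l.count m ≠ 0 := by
  refine mul_ne_zero (mul_ne_zero ?_ hW) ?_
  · norm_cast
    omega
  · exact_mod_cast (List.count_pos_iff.mpr hl).ne'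

/-- If an endomorphism kills `v`, then the coordinates of the images of the basis vectors in the
support of `v` cannot vanish for all but one of them. -/
theorem repr_eq_zero_of_unique (T : Module.End ℂ (LQuot φ ξ)) (hT : T v = 0)
    (p₀ q : NonposPartition × NonposPartition)
    (h : ∀ p, (monomialBasis φ ξ).repr v p ≠ 0 → p ≠ p₀ →
      (monomialBasis φ ξ).repr (T (monomialBasis φ ξ p)) q = 0)
    (h₀ : (monomialBasis φ ξ).repr (T (monomialBasis φ ξ p₀)) q ≠ 0) :
    (monomialBasis φ ξ).repr v p₀ = 0 := by
  set b := monomialBasis φ ξ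
  have hv := congrArg (fun y => b.repr (T y) q) (b.linearCombination_repr v)
  simp only [hT, map_zero, Finsupp.zero_apply, Finsupp.linearCombination_apply, Finsupp.sum,
    map_sum, map_smul, Finsupp.coe_finsetSum, Finset.sum_apply, Finsupp.smul_apply,
    smul_eq_mul] at hv
  rw [Finset.sum_eq_single p₀ (fun p hp hne => by rw [h p (Finsupp.mem_support_iff.mp hp) hne,
    mul_zero]) (fun hp => by rw [Finsupp.notMem_support_iff.mp hp, zero_mul])] at hv
  exact (mul_eq_zero.mp hv).resolve_right h₀

/-- The operator `x - φ (x)`. -/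
noncomputable def shifted (φ : LieAlgebra.LieCharacter ℂ plus) (ξ : ℂ) (x : W22) :
    Module.End ℂ (LQuot φ ξ) :=
  Module.toModuleEnd ℂ (S := U) (LQuot φ ξ) (toU x) - scalar φ ξ x • 1

theorem shifted_apply (x : W22) (y : LQuot φ ξ) :
    shifted φ ξ x y = toU x • y - scalar φ ξ x • y := rfl

theorem IsWhittakerVector.shifted_eq_zero (hv : IsWhittakerVector φ v) {x : W22} (hx : x ∈ plus) :
    shifted φ ξ x v = 0 := by
  rw [shifted_apply, hv ⟨x, hx⟩, ← scalar_plus φ ξ, sub_self]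

/-- Otherwise `W (2 - m) - φ (W (2 - m))` would have a nonzero coordinate on `v`, for `m` the least
first part among the monomials with the most letters `L`. -/
theorem IsWhittakerVector.fst_eq_nil (hv : IsWhittakerVector φ v) (hW : scalar φ ξ (W 2) ≠ 0)
    (p : NonposPartition × NonposPartition) (hp : (monomialBasis φ ξ).repr v p ≠ 0) :
    p.1.parts = [] := by
  classical
  by_contra hne
  set b := monomialBasis φ ξ with hb
  obtain ⟨p₁, hp₁, hmax⟩ := (b.repr v).support.exists_max_image (fun p => p.1.parts.length)
    ⟨p, Finsupp.mem_support_iff.mpr hp⟩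
  -- The default of `headD` plays no role: the maximal length is positive, so every partition
  -- compared here is non-empty.
  obtain ⟨p₀, hp₀, hmin⟩ := ((b.repr v).support.filter fun p =>
    p.1.parts.length = p₁.1.parts.length).exists_min_image (fun p => p.1.parts.headD 0)
    ⟨p₁, by simpa using hp₁⟩
  obtain ⟨hp₀, hlen⟩ := Finset.mem_filter.mp hp₀
  have hne₀ : p₀.1.parts ≠ [] := by
    have h₁ := hmax p (Finsupp.mem_support_iff.mpr hp)
    have h₂ := List.length_pos_iff.mpr hne
    exact List.length_pos_iff.mp (by omega)
  have hmem := NonposPartition.headD_mem hne₀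
  have hm := p₀.1.nonpos _ hmem
  set m := p₀.1.parts.headD 0
  have hpos := List.length_pos_iff.mpr hne₀
  have hq : (p₀.1.tail.parts).length + 1 = p₀.1.parts.length := by
    simp only [NonposPartition.tail, List.length_tail]
    omega
  have lead : ∀ p : NonposPartition × NonposPartition,
      p.1.parts.length = p₁.1.parts.length → (∀ i ∈ p.1.parts, m ≤ i) →
      b.repr (shifted φ ξ (W (2 - m)) (b p)) (p₀.1.tail, p₀.2) =
      ((2 * (m : ℂ) - 2) * scalar φ ξ (W 2) * p.1.parts.count m) *
        if (p.1.tail, p.2) = (p₀.1.tail, p₀.2) then 1 else 0 := by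
    intro p hl hmp
    have h := repr_eq_zero_of_mem_filt φ ξ
      (W_smul_vec_leading φ ξ hm p.1.sorted hmp p.2.parts) (q := (p₀.1.tail, p₀.2)) (by
        change _ < p₀.1.tail.parts.length + 2
        omega)
    rw [map_sub, Finsupp.sub_apply, sub_eq_zero] at h
    rw [shifted_apply, hb, monomialBasis_eq_vec, h, map_smul, Finsupp.smul_apply, smul_eq_mul]
    congr 1
    have e := monomialBasis_eq_vec φ ξ (p.1.tail, p.2)
    change _ = vec φ ξ p.1.parts.tail p.2.parts at e
    rw [← e, Module.Basis.repr_self, Finsupp.single_apply]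
  refine Finsupp.mem_support_iff.mp hp₀ (repr_eq_zero_of_unique (shifted φ ξ (W (2 - m)))
    (hv.shifted_eq_zero (W_mem_plus (by omega))) p₀ (p₀.1.tail, p₀.2) ?_ ?_)
  · intro p hp hne
    have hp := Finsupp.mem_support_iff.mpr hp
    -- Monomials with fewer letters `L` land below the length of `p₀.1.tail`. Those of maximal
    -- length contribute a multiple of their tail, which is zero if `m` is absent and belongs to
    -- another monomial if `m` is present.
    rcases (hmax p hp).lt_or_eq with hlt | heq
    · rw [shifted_apply, monomialBasis_eq_vec]
      refine repr_eq_zero_of_mem_filt φ ξ (W_smul_vec_sub_mem φ ξ (by omega) _ _) ?_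
      change _ < p₀.1.tail.parts.length + 1
      omega
    · have hmp : ∀ i ∈ p.1.parts, m ≤ i := fun i hi =>
        (hmin p (Finset.mem_filter.mpr ⟨hp, heq⟩)).trans (p.1.headD_le i hi)
      rw [← hb, lead p heq hmp]
      by_cases hmem' : m ∈ p.1.parts
      · rw [if_neg, mul_zero]
        intro e
        obtain ⟨e₁, e₂⟩ := Prod.mk.inj e
        exact hne (Prod.ext (NonposPartition.eq_of_tail_eq hmp p₀.1.headD_le hmem' hmem e₁) e₂)
      · rw [List.count_eq_zero_of_not_mem hmem']
        simp
  · rw [← hb, lead p₀ hlen p₀.1.headD_le, if_pos rfl, mul_one]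
    exact leading_ne_zero hm hW hmem

/-- By `fst_eq_nil` only monomials in the `W n` occur. On them `L (2 - m) - φ (L (2 - m))` acts
without error terms, so no maximal length has to be fixed before choosing the least first part `m`.
-/
theorem IsWhittakerVector.snd_eq_nil (hv : IsWhittakerVector φ v) (hW : scalar φ ξ (W 2) ≠ 0)
    (p : NonposPartition × NonposPartition) (hp : (monomialBasis φ ξ).repr v p ≠ 0) :
    p.2.parts = [] := by
  classical
  by_contra hne
  set b := monomialBasis φ ξ with hb
  obtain ⟨p₀, hp₀, hmin⟩ := ((b.repr v).support.filter fun p =>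
    p.2.parts ≠ []).exists_min_image (fun p => p.2.parts.headD 0)
    ⟨p, by simpa using ⟨hp, hne⟩⟩
  obtain ⟨hp₀, hne₀⟩ := Finset.mem_filter.mp hp₀
  have hmem := NonposPartition.headD_mem hne₀
  have hm := p₀.2.nonpos _ hmem
  set m := p₀.2.parts.headD 0
  have lead : ∀ p : NonposPartition × NonposPartition,
      p.1.parts = [] → (∀ i ∈ p.2.parts, m ≤ i) →
      b.repr (shifted φ ξ (L (2 - m)) (b p)) (p₀.1, p₀.2.tail) =
      ((2 * (m : ℂ) - 2) * scalar φ ξ (W 2) * p.2.parts.count m) *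
        if (p.1, p.2.tail) = (p₀.1, p₀.2.tail) then 1 else 0 := by
    intro p hl hmp
    have e := monomialBasis_eq_vec φ ξ (p.1, p.2.tail)
    change _ = vec φ ξ p.1.parts p.2.parts.tail at e
    rw [hl] at e
    rw [shifted_apply, hb, monomialBasis_eq_vec, hl, L_smul_vec_nil φ ξ hm p.2.sorted hmp,
      add_sub_cancel_left, map_smul, Finsupp.smul_apply, smul_eq_mul, ← e,
      Module.Basis.repr_self, Finsupp.single_apply]
  refine Finsupp.mem_support_iff.mp hp₀ (repr_eq_zero_of_unique (shifted φ ξ (L (2 - m)))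
    (hv.shifted_eq_zero (L_mem_plus (by omega))) p₀ (p₀.1, p₀.2.tail) ?_ ?_)
  · intro p hp hne
    have hmp : ∀ i ∈ p.2.parts, m ≤ i := fun i hi =>
      (hmin p (Finset.mem_filter.mpr ⟨Finsupp.mem_support_iff.mpr hp,
        List.ne_nil_of_mem hi⟩)).trans (p.2.headD_le i hi)
    rw [← hb, lead p (hv.fst_eq_nil hW p hp) hmp]
    by_cases hmem' : m ∈ p.2.parts
    · rw [if_neg, mul_zero]
      intro e
      obtain ⟨e₁, e₂⟩ := Prod.mk.inj e
      exact hne (Prod.ext e₁ (NonposPartition.eq_of_tail_eq hmp p₀.2.headD_le hmem' hmem e₂))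
    · rw [List.count_eq_zero_of_not_mem hmem']
      simp
  · rw [← hb, lead p₀ (hv.fst_eq_nil hW p₀ (Finsupp.mem_support_iff.mp hp₀)) p₀.2.headD_le,
      if_pos rfl, mul_one]
    exact leading_ne_zero hm hW hmem

/-- Whittaker vectors of `L_{φ,ξ}` are multiples of the cyclic vector. -/
theorem IsWhittakerVector.exists_eq_smul (hv : IsWhittakerVector φ v)
    (hW : scalar φ ξ (W 2) ≠ 0) : ∃ c : ℂ, v = c • wBar φ ξ := by
  let e : NonposPartition := ⟨[], by simp, by simp⟩
  refine ⟨(monomialBasis φ ξ).repr v (e, e), ?_⟩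
  have he : wBar φ ξ = monomialBasis φ ξ (e, e) := by
    rw [monomialBasis_eq_vec, vec_nil_nil]
  rw [he]
  nth_rewrite 1 [← (monomialBasis φ ξ).linearCombination_repr v]
  rw [Finsupp.linearCombination_apply, Finsupp.sum]
  refine Finset.sum_eq_single (e, e) (fun p hp hne => absurd ?_ hne) fun h => ?_
  · have hp := Finsupp.mem_support_iff.mp hp
    exact Prod.ext (NonposPartition.ext (hv.fst_eq_nil hW p hp))
      (NonposPartition.ext (hv.snd_eq_nil hW p hp))
  · rw [Finsupp.notMem_support_iff.mp h, zero_smul]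

end Uniqueness

end W22

theorem proposition3p2 (φ : LieAlgebra.LieCharacter ℂ W22.plus) (hφ : W22.NonSingular φ) (ξ : ℂ) :
    (∃ b : Module.Basis (W22.NonposPartition × W22.NonposPartition) ℂ (W22.LQuot φ ξ),
      ∀ l m : W22.NonposPartition,
        b (l, m) = (W22.LMon l * W22.WMon m) • W22.wBar φ ξ) ∧
    ∀ w' : W22.LQuot φ ξ, W22.IsWhittakerVector φ w' → ∃ c : ℂ, w' = c • W22.wBar φ ξ := by
  refine ⟨⟨W22.monomialBasis φ ξ, fun l m => ?_⟩, fun w' hw' => hw'.exists_eq_smul ?_⟩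
  · rw [W22.monomialBasis_apply, W22.wordVec_monomialWord]
  · rw [W22.scalar_W φ ξ two_pos]
    exact right_ne_zero_of_mul hφ.2
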